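/- **Setting.** Let $d\ge 1$, let $\Omega\subset\mathbb R^d$ be compact, put $\hat f(\omega)=\int_{\mathbb R^d} f(x)e^{-\mathrm i\omega\cdot x}\,dx$ and $$B(\Omega)=\{f\in L^2(\mathbb R^d):\ \operatorname{supp}\hat f\subseteq\Omega\},\qquad m_\Omega=\sup_{\omega\in\Omega}|\omega|_2 .$$ Let $|\cdot|_*$ be a norm on $\mathbb R^d$ and $b>0$ the least constant with $|x|_2\le b|x|_*$ for all $x$. Let $\{x_n\}_{n\in I}\subset\mathbb R^d$ be countable, with $$V_n=\{x:\ |x-x_n|_*\le|x-x_m|_*\ \ \forall m\ne n\},\qquad \delta=\sup_{x\in\mathbb R^d}\inf_{n\in I}|x-x_n|_* ,$$ and assume that the Voronoi cells $V_n$ form a partition of $\mathbb R^d$ up to null sets, i.e. almost every $x$ lies in exactly one $V_n$. For $\alpha\in\mathbb N_0^d$ put $$\mu_{n,\alpha}=\frac1{\alpha!}\int_{V_n}(x-x_n)^{2\alpha}\,dx,\qquad \Phi_\Omega(x)=\frac1{(2\pi)^d}\int_\Omega e^{\mathrm i\omega\cdot x}\,d\omega ,$$ and for $k\in\mathbb N_0$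 and $z>0$ $$R_k(z)=e^z-\sum_{r=0}^k\frac{z^r}{r!},\quad h_k(z)=e^zR_k(z),\quad \sigma_d^*(z)=\frac{z+\sqrt{z(d+z)}}d,$$ $$g_{k,d}(z)=\bigl(1+2\sigma_d^*(z)\bigr)^{d/2}e^{z/\sigma_d^*(z)}R_k(z),\quad q_{k,d}(z)=\min\{h_k(z),g_{k,d}(z)\},\quad q_{k,d}(0)=0 .$$ Write $z=m_\Omega b\delta$. A family $(\phi_j)_j$ in $B(\Omega)$ is a frame with bounds $A,B>0$ if $A\|f\|^2\le\sum_j|\langle f,\phi_j\rangle|^2\le B\|f\|^2$ for all $f\in B(\Omega)$. An upper limit for $\delta$ with denominator $m_\Omega b=0$ is read as $\infty$. **Statement.** Let $d\ge1$. 1. There is $K=K(d)$ such that for every $k\ge K$ and all $\Omega$, $|\cdot|_*$, $\{x_n\}$ as above: if $$\delta<\frac{1}{e}\,\frac{k+1}{m_\Omega b},$$ then $\{\sqrt{\mu_{n,\alpha}}\,D^\alpha\Phi_\Omega(\cdot-x_n):n\in I,\ |\alpha|_1\le k\}$ is a frame for $B(\Omega)$ with some bounds $A,B>0$ satisfying $$A\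 \ge\ e^{-d}\bigl(1-q_{k,d}(z)\bigr)^2\ \text{ if } q_{k,d}(z)\le1,\qquad B\ \le\ \exp(2z+z^2).$$ 2. For every $0<c<1/e$ there is $K=K(c,d)$ such that for every $k\ge K$ and all $\Omega$, $|\cdot|_*$, $\{x_n\}$ as above: if $$\delta<c\,\frac{k+1}{m_\Omega b},$$ then $q_{k,d}(z)<1$, and the same family is a frame for $B(\Omega)$ with some bounds $A,B>0$ satisfying $$A\ \ge\ e^{-d}\bigl(1-q_{k,d}(z)\bigr)^2,\qquad B\ \le\ \exp(2z+z^2).$$ -/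

import Mathlib

open MeasureTheory FourierTransform

noncomputable section

/-- `ℝᵈ` with Euclidean norm and Lebesgue measure. -/
abbrev Rd (d : ℕ) : Type := EuclideanSpace ℝ (Fin d)

/-- `L²(ℝᵈ)`, complex valued. -/
abbrev L2 (d : ℕ) : Type := Lp (α := Rd d) ℂ 2

/-- The space `B(Ω)` of functions in `L²(ℝᵈ)` whose Fourier transform is supported in the
closed set `Ω`. Mathlib's transform `𝓕 f` has the kernel `exp (-2πi ξ·x)`, so that
`f̂(ω) = ∫ f(x) exp (-i ω·x) dx` is `𝓕 f (ω / 2π)`. -/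
def bandlimited {d : ℕ} (Ω : Set (Rd d)) : Submodule ℂ (L2 d) where
  carrier := {f | ∀ᵐ ξ : Rd d, (2 * Real.pi) • ξ ∉ Ω → (𝓕 f : L2 d) ξ = 0}
  zero_mem' := by
    have h0 : (𝓕 (0 : L2 d) : L2 d) = 0 := (Lp.fourierTransformₗᵢ (Rd d) ℂ).map_zero
    simp only [Set.mem_ofPred_eq]
    rw [h0]
    filter_upwards [Lp.coeFn_zero ℂ 2 (volume : Measure (Rd d))] with ξ hξ _
    simp [hξ]
  add_mem' := by
    intro f g hf hg
    simp only [Set.mem_ofPred_eq] at hf hg ⊢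
    have h : (𝓕 (f + g) : L2 d) = 𝓕 f + 𝓕 g :=
      (Lp.fourierTransformₗᵢ (Rd d) ℂ).map_add f g
    rw [h]
    filter_upwards [hf, hg, Lp.coeFn_add (𝓕 f : L2 d) (𝓕 g)] with ξ h1 h2 h3 hξ
    rw [h3, Pi.add_apply, h1 hξ, h2 hξ, add_zero]
  smul_mem' := by
    intro c f hf
    simp only [Set.mem_ofPred_eq] at hf ⊢
    have h : (𝓕 (c • f) : L2 d) = c • 𝓕 f :=
      (Lp.fourierTransformₗᵢ (Rd d) ℂ).map_smul c f
    rw [h]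
    filter_upwards [hf, Lp.coeFn_smul c (𝓕 f : L2 d)] with ξ h1 h3 hξ
    rw [h3, Pi.smul_apply, h1 hξ, smul_zero]

/-- `φ` is a frame for the inner product space `H` with frame bounds `A, B > 0`. -/
def IsFrameWithBounds {H J : Type*} [NormedAddCommGroup H] [InnerProductSpace ℂ H]
    (φ : J → H) (A B : ℝ) : Prop :=
  0 < A ∧ 0 < B ∧ ∀ f : H, Summable (fun j => ‖inner ℂ (φ j) f‖ ^ 2) ∧
    A * ‖f‖ ^ 2 ≤ ∑' j, ‖inner ℂ (φ j) f‖ ^ 2 ∧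
    ∑' j, ‖inner ℂ (φ j) f‖ ^ 2 ≤ B * ‖f‖ ^ 2

/-- Partial derivative in the `i`-th coordinate. -/
def coordDeriv {d : ℕ} (i : Fin d) (f : Rd d → ℂ) : Rd d → ℂ :=
  fun x => fderiv ℝ f x (EuclideanSpace.single i 1)

/-- `D^α = ∂₁^{α₁} ⋯ ∂_d^{α_d}`. -/
def multiDeriv {d : ℕ} (α : Fin d → ℕ) (f : Rd d → ℂ) : Rd d → ℂ :=
  (List.finRange d).foldr (fun i g => (coordDeriv i)^[α i] g) f

/-- The multi-indices `α` with `|α|₁ ≤ k`. -/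
abbrev MultiIndexLE (d k : ℕ) : Type := {α : Fin d → ℕ // ∑ i, α i ≤ k}

/-- `Φ_Ω(x) = (2π)^{-d} ∫_Ω exp (i ω·x) dω`. -/
def bandKernel {d : ℕ} (Ω : Set (Rd d)) (x : Rd d) : ℂ :=
  (1 / (2 * Real.pi) ^ d : ℝ) * ∫ ω in Ω, Complex.exp (Complex.I * (inner ℝ ω x : ℝ))

/-- The Voronoi cell `V_n` of `x n` with respect to `N`. -/
def voronoiCell {d : ℕ} {I : Type*} (N : Seminorm ℝ (Rd d)) (x : I → Rd d) (n : I) :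
    Set (Rd d) :=
  {y | ∀ m, m ≠ n → N (y - x n) ≤ N (y - x m)}

/-- The weight `μ_{n,α} = (1/α!) ∫_{V_n} (y - x_n)^{2α} dy`. -/
def sampleWeight {d : ℕ} {I : Type*} (N : Seminorm ℝ (Rd d)) (x : I → Rd d) (n : I)
    (α : Fin d → ℕ) : ℝ :=
  (1 / ∏ i, ((α i).factorial : ℝ)) *
    ∫ y in voronoiCell N x n, ∏ i, (y i - x n i) ^ (2 * α i)

/-- The density `δ = sup_y inf_n N (y - x_n)`, in `[0, ∞]`. -/
def sampleGap {d : ℕ} {I : Type*} (N : Seminorm ℝ (Rd d)) (x : I → Rd d) : ENNReal :=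
  ⨆ y : Rd d, ⨅ n : I, ENNReal.ofReal (N (y - x n))

/-- The least constant `b > 0` with `|x|₂ ≤ b N x` for all `x`. -/
def normConst {d : ℕ} (N : Seminorm ℝ (Rd d)) : ℝ :=
  sInf {b : ℝ | 0 < b ∧ ∀ x, ‖x‖ ≤ b * N x}

/-- `m_Ω = sup_{ω ∈ Ω} |ω|₂` (and `0` for empty `Ω`). -/
def bandRadius {d : ℕ} (Ω : Set (Rd d)) : ℝ :=
  sSup ((fun ω => ‖ω‖) '' Ω)

/-- `R_k(z) = exp z - ∑_{r ≤ k} z^r / r!`. -/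
def expRemainder (k : ℕ) (z : ℝ) : ℝ :=
  Real.exp z - ∑ r ∈ Finset.range (k + 1), z ^ r / (r.factorial : ℝ)

/-- `σ*_d(z)`. -/
def sigmaStar (d : ℕ) (z : ℝ) : ℝ := (z + Real.sqrt (z * (d + z))) / d

/-- `h_k(z)`. -/
def hFun (k : ℕ) (z : ℝ) : ℝ := Real.exp z * expRemainder k z

/-- `g_{k,d}(z)`. At `z = 0` the conventions of division give the limiting value `0`. -/
def gFun (k d : ℕ) (z : ℝ) : ℝ :=
  (1 + 2 * sigmaStar d z) ^ ((d : ℝ) / 2) * Real.exp (z / sigmaStar d z) * expRemainder k z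

/-- The functions `√μ_{n,α} D^α Φ_Ω(· - x_n)`, `n ∈ I`, `|α|₁ ≤ k`, belong to `B(Ω)`, and form
a frame for `B(Ω)` with frame bounds `A, B > 0`. -/
def IsDerivativeFrame {d : ℕ} {I : Type*} (Ω : Set (Rd d)) (N : Seminorm ℝ (Rd d))
    (x : I → Rd d) (k : ℕ) (A B : ℝ) : Prop :=
  ∃ ψ : I × MultiIndexLE d k → bandlimited Ω,
    (∀ n α, ((ψ (n, α) : L2 d) : Rd d → ℂ) =ᵐ[volume]
      fun y => (Real.sqrt (sampleWeight N x n α.1) : ℂ) *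
        multiDeriv α.1 (bandKernel Ω) (y - x n)) ∧
    IsFrameWithBounds ψ A B

end

theorem hasSum_expRemainder (k : ℕ) (z : ℝ) :
    HasSum (fun j : ℕ => z ^ (j + (k + 1)) / ((j + (k + 1)).factorial : ℝ)) (expRemainder k z) := by
  rw [expRemainder, hasSum_nat_add_iff' (f := fun j : ℕ => z ^ j / (j.factorial : ℝ)) (k + 1)]
  rw [Real.exp_eq_exp_ℝ]
  exact NormedSpace.expSeries_div_hasSum_exp z

theorem expRemainder_nonneg (k : ℕ) {z : ℝ} (hz : 0 ≤ z) : 0 ≤ expRemainder k z :=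
  (hasSum_expRemainder k z).nonneg fun _ => by positivity

theorem expRemainder_pos (k : ℕ) {z : ℝ} (hz : 0 < z) : 0 < expRemainder k z :=
  lt_of_lt_of_le (by positivity)
    (le_hasSum (hasSum_expRemainder k z) 0 fun _ _ => by positivity)

theorem continuous_expRemainder (k : ℕ) : Continuous (expRemainder k) := by
  unfold expRemainder
  fun_prop

theorem expRemainder_mono (k : ℕ) {z w : ℝ} (hz : 0 ≤ z) (h : z ≤ w) :
    expRemainder k z ≤ expRemainder k w :=
  hasSum_le (fun j => by gcongr) (hasSum_expRemainder k z) (hasSum_expRemainder k w)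

theorem expRemainder_le {k : ℕ} {z c : ℝ} (hz : 0 ≤ z) (hc : c < 1) (hzc : z ≤ c * (k + 1)) :
    expRemainder k z ≤ z ^ (k + 1) / ((k + 1).factorial : ℝ) / (1 - c) := by
  have hk : (0 : ℝ) < k + 1 := by positivity
  have hc0 : 0 ≤ c := by
    by_contra! h
    nlinarith [mul_neg_of_neg_of_pos h hk]
  have hg := (hasSum_geometric_of_lt_one hc0 hc).mul_left (z ^ (k + 1) / ((k + 1).factorial : ℝ))
  rw [← div_eq_mul_inv] at hg
  refine hasSum_le (fun j => ?_) (hasSum_expRemainder k z) hg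
  have h1 : ((k + 1).factorial : ℝ) * (k + 1) ^ j ≤ ((j + (k + 1)).factorial : ℝ) := by
    have := Nat.factorial_mul_pow_le_factorial (m := k + 1) (n := j)
    rw [add_comm j]
    calc ((k + 1).factorial : ℝ) * (k + 1) ^ j
        ≤ ((k + 1).factorial : ℝ) * ((k + 1 : ℕ) + 1) ^ j := by
          gcongr; linarith
      _ ≤ _ := by exact_mod_cast this
  calc z ^ (j + (k + 1)) / ((j + (k + 1)).factorial : ℝ)
      ≤ z ^ (j + (k + 1)) / (((k + 1).factorial : ℝ) * (k + 1) ^ j) := by gcongr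
    _ = z ^ (k + 1) / ((k + 1).factorial : ℝ) * (z / (k + 1)) ^ j := by
        rw [pow_add, div_pow]; field_simp
    _ ≤ _ := by
        gcongr
        rwa [div_le_iff₀ hk]

theorem pow_div_factorial_le {k : ℕ} {z c : ℝ} (hz : 0 ≤ z) (hzc : z ≤ c * (k + 1)) :
    z ^ (k + 1) / ((k + 1).factorial : ℝ) ≤ (c * Real.exp 1) ^ (k + 1) / 2 := by
  have hk : (0 : ℝ) < k + 1 := by positivity
  have hs := Stirling.le_factorial_stirling (k + 1)
  have h2 : (2 : ℝ) ≤ √(2 * Real.pi * ((k + 1 : ℕ) : ℝ)) := by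
    apply Real.le_sqrt_of_sq_le
    push_cast
    nlinarith [Real.pi_gt_three, mul_nonneg Real.pi_pos.le (Nat.cast_nonneg (α := ℝ) k)]
  have h3 : 2 * (((k + 1 : ℕ) : ℝ) / Real.exp 1) ^ (k + 1) ≤ ((k + 1).factorial : ℝ) :=
    le_trans (by gcongr) hs
  rw [div_le_div_iff₀ (by positivity) (by norm_num)]
  calc z ^ (k + 1) * 2 ≤ (c * (k + 1)) ^ (k + 1) * 2 := by gcongr
    _ = (c * Real.exp 1) ^ (k + 1) * (2 * (((k + 1 : ℕ) : ℝ) / Real.exp 1) ^ (k + 1)) := by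
        push_cast
        rw [mul_left_comm, ← mul_pow, mul_comm]
        congr 2
        field_simp
    _ ≤ _ := by
        have hc : 0 ≤ c := by
          by_contra! h
          nlinarith [mul_neg_of_neg_of_pos h hk]
        gcongr

theorem expRemainder_lt_one {k : ℕ} {z : ℝ} (hz : 0 ≤ z) (h : z ≤ (k + 1) / Real.exp 1) :
    expRemainder k z < 1 := by
  have he : (2.7 : ℝ) < Real.exp 1 := by linarith [Real.exp_one_gt_d9]
  have hc : 1 / Real.exp 1 < 2 / 5 := by
    rw [div_lt_div_iff₀ (by positivity) (by norm_num)]; linarith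
  have hzc : z ≤ 1 / Real.exp 1 * (k + 1) := by rw [one_div, mul_comm]; exact h
  have h1 := expRemainder_le hz (by linarith) hzc
  have h2 := pow_div_factorial_le hz hzc
  rw [one_div, inv_mul_cancel₀ (Real.exp_pos 1).ne', one_pow] at h2
  refine lt_of_le_of_lt h1 ?_
  rw [div_lt_one (by linarith)]
  linarith

theorem sigmaStar_nonneg (d : ℕ) {z : ℝ} (hz : 0 ≤ z) : 0 ≤ sigmaStar d z := by
  unfold sigmaStar; positivity

theorem sigmaStar_pos {d : ℕ} (hd : 1 ≤ d) {z : ℝ} (hz : 0 < z) : 0 < sigmaStar d z := by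
  have : (0 : ℝ) < d := by exact_mod_cast hd
  unfold sigmaStar; positivity

theorem one_add_two_sigmaStar_le {d : ℕ} (hd : 1 ≤ d) {z : ℝ} (hz : 0 ≤ z) :
    1 + 2 * sigmaStar d z ≤ 3 + 4 * z := by
  have hd' : (1 : ℝ) ≤ d := by exact_mod_cast hd
  have h1 : √(z * (d + z)) ≤ d + z := by
    apply Real.sqrt_le_iff.mpr ⟨by positivity, ?_⟩
    nlinarith
  have : sigmaStar d z ≤ 1 + 2 * z := by
    unfold sigmaStar
    rw [div_le_iff₀ (by positivity)]
    nlinarith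
  linarith

theorem div_sigmaStar_le {d : ℕ} (hd : 1 ≤ d) {z : ℝ} (hz : 0 ≤ z) : z / sigmaStar d z ≤ d := by
  have hd' : (1 : ℝ) ≤ d := by exact_mod_cast hd
  refine div_le_of_le_mul₀ (sigmaStar_nonneg d hz) (by positivity) ?_
  unfold sigmaStar
  rw [mul_div_cancel₀ _ (by positivity)]
  linarith [Real.sqrt_nonneg (z * (d + z))]

theorem gFun_le {d k : ℕ} (hd : 1 ≤ d) {z c : ℝ} (hz : 0 ≤ z) (hc : c < 1)
    (hzc : z ≤ c * (k + 1)) :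
    gFun k d z ≤ (7 * (k + 1)) ^ d * Real.exp d *
      ((c * Real.exp 1) ^ (k + 1) / 2 / (1 - c)) := by
  have hk : (0 : ℝ) ≤ k := by positivity
  have hz' : z ≤ k + 1 := hzc.trans (by nlinarith)
  have hs := sigmaStar_nonneg d hz
  have h1 : (1 + 2 * sigmaStar d z) ^ ((d : ℝ) / 2) ≤ (7 * (k + 1)) ^ d := by
    rw [← Real.rpow_natCast]
    have hb : 1 + 2 * sigmaStar d z ≤ 7 * (k + 1) := by
      linarith [one_add_two_sigmaStar_le hd hz]
    calc (1 + 2 * sigmaStar d z) ^ ((d : ℝ) / 2) ≤ (7 * (k + 1) : ℝ) ^ ((d : ℝ) / 2) := by gcongr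
      _ ≤ _ := by
        apply Real.rpow_le_rpow_of_exponent_le
        · linarith
        · have : (0 : ℝ) ≤ d := by positivity
          linarith
  have h2 := expRemainder_le hz hc hzc
  have h3 := pow_div_factorial_le hz hzc
  have h4 := div_sigmaStar_le hd hz
  have h5 := expRemainder_nonneg k hz
  have hc' : 0 < 1 - c := by linarith
  unfold gFun
  gcongr
  exact h2.trans (by gcongr)

theorem exists_gFun_lt_one {d : ℕ} (hd : 1 ≤ d) {c : ℝ} (hc0 : 0 < c)
    (hc : c < 1 / Real.exp 1) :
    ∃ K : ℕ, ∀ k : ℕ, K ≤ k → ∀ z : ℝ, 0 ≤ z → z ≤ c * (k + 1) → gFun k d z < 1 := by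
  have he : (1 : ℝ) < Real.exp 1 := by linarith [Real.exp_one_gt_d9]
  have hc1 : c < 1 := hc.trans (by rw [div_lt_one (by positivity)]; exact he)
  have hce : c * Real.exp 1 < 1 := by rwa [lt_div_iff₀ (by positivity)] at hc
  have ht := (tendsto_pow_const_mul_const_pow_of_abs_lt_one d (r := c * Real.exp 1)
    (by rw [abs_of_pos (by positivity)]; exact hce)).const_mul
    (7 ^ d * Real.exp d / 2 / (1 - c))
  rw [mul_zero] at ht
  have ht' := (ht.comp (Filter.tendsto_add_atTop_nat 1)).eventually (gt_mem_nhds one_pos)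
  obtain ⟨K, hK⟩ := Filter.eventually_atTop.mp ht'
  refine ⟨K, fun k hk z hz hzc => lt_of_le_of_lt (gFun_le hd hz hc1 hzc) ?_⟩
  refine lt_of_eq_of_lt ?_ (hK k hk)
  simp only [Function.comp]
  push_cast
  rw [mul_pow]
  ring

theorem hasSum_cos_two_pi_mul_div_sq {x : ℝ} (hx : x ∈ Set.Icc (0 : ℝ) 1) :
    HasSum (fun n : ℕ => 1 / (n : ℝ) ^ 2 * Real.cos (2 * Real.pi * n * x))
      (Real.pi ^ 2 * (x ^ 2 - x + 1 / 6)) := by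
  have h := hasSum_one_div_nat_pow_mul_cos (k := 1) one_ne_zero hx
  convert! h using 1
  simp [Polynomial.bernoulli_def, Finset.sum_range_succ, Nat.choose, bernoulli_one,
    bernoulli_two, Polynomial.eval_add, Nat.factorial]
  ring

theorem hasSum_odd_cos {x : ℝ} (hx : x ∈ Set.Icc (0 : ℝ) (1 / 2)) :
    HasSum (fun j : ℕ => 1 / (2 * (j : ℝ) + 1) ^ 2 * Real.cos (2 * Real.pi * (2 * j + 1) * x))
      (Real.pi ^ 2 * (1 / 8 - x / 2)) := by
  have h1 := hasSum_cos_two_pi_mul_div_sq (x := x) ⟨hx.1, by linarith [hx.2]⟩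
  have h2 := (hasSum_cos_two_pi_mul_div_sq (x := 2 * x)
    ⟨by linarith [hx.1], by linarith [hx.2]⟩).mul_left (1 / 4)
  generalize hF : (fun n : ℕ => 1 / (n : ℝ) ^ 2 * Real.cos (2 * Real.pi * n * x)) = F at h1
  have heven : HasSum (fun j : ℕ => F (2 * j))
      (1 / 4 * (Real.pi ^ 2 * ((2 * x) ^ 2 - 2 * x + 1 / 6))) := by
    convert! h2 using 2 with j
    rw [← hF]
    dsimp only
    rw [Nat.cast_mul, Nat.cast_two, mul_pow,
      show 2 * Real.pi * (2 * (j : ℝ)) * x = 2 * Real.pi * j * (2 * x) by ring,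
      show (1 : ℝ) / (2 ^ 2 * (j : ℝ) ^ 2) = 1 / 4 * (1 / (j : ℝ) ^ 2) by
        rw [one_div_mul_one_div]; norm_num]
    ring
  have hodd : Summable fun j : ℕ => F (2 * j + 1) :=
    h1.summable.comp_injective (i := fun j : ℕ => 2 * j + 1)
      (fun a b h => by dsimp only at h; omega)
  have h3 := (HasSum.even_add_odd heven hodd.hasSum).unique h1
  have h4 := hodd.hasSum
  rw [eq_sub_of_add_eq' h3] at h4
  have h5 : ∀ j : ℕ, F (2 * j + 1) =
      1 / (2 * (j : ℝ) + 1) ^ 2 * Real.cos (2 * Real.pi * (2 * j + 1) * x) := fun j => by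
    rw [← hF]; push_cast; rfl
  simp_rw [h5] at h4
  rw [show Real.pi ^ 2 * (1 / 8 - x / 2) = Real.pi ^ 2 * (x ^ 2 - x + 1 / 6) -
    1 / 4 * (Real.pi ^ 2 * ((2 * x) ^ 2 - 2 * x + 1 / 6)) by ring]
  exact h4

theorem exists_sine_series {L : ℝ} (hL : 0 < L) :
    ∃ c t : ℕ → ℝ, HasSum (fun j => |c j|) L ∧
      ∀ s : ℝ, |s| ≤ L → HasSum (fun j => c j * Real.sin (t j * s)) s := by
  have hpi := Real.pi_pos
  refine ⟨fun j => 8 * L / Real.pi ^ 2 * ((-1) ^ j / (2 * (j : ℝ) + 1) ^ 2),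
    fun j => (2 * j + 1) * Real.pi / (2 * L), ?_, fun s hs => ?_⟩
  · have h := (hasSum_odd_cos (x := 0) ⟨le_rfl, by norm_num⟩).mul_left (8 * L / Real.pi ^ 2)
    convert! h using 1
    · ext j
      rw [abs_mul, abs_of_pos (a := 8 * L / Real.pi ^ 2) (by positivity), abs_div, abs_pow, abs_neg,
        abs_one, one_pow, abs_of_pos (by positivity)]
      simp
    · field_simp; norm_num
  · have hs' := abs_le.mp hs
    have hx : (1 / 4 - s / (4 * L)) ∈ Set.Icc (0 : ℝ) (1 / 2) := by
      constructor
      · have : s / (4 * L) ≤ 1 / 4 := by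
          rw [div_le_div_iff₀ (by positivity) (by norm_num)]; linarith
        linarith
      · have : -(1 / 4) ≤ s / (4 * L) := by
          rw [le_div_iff₀ (by positivity)]; linarith
        linarith
    have h := (hasSum_odd_cos hx).mul_left (8 * L / Real.pi ^ 2)
    convert! h using 1
    · ext j
      have : Real.cos (2 * Real.pi * (2 * j + 1) * (1 / 4 - s / (4 * L))) =
          (-1) ^ j * Real.sin ((2 * j + 1) * Real.pi / (2 * L) * s) := by
        rw [show 2 * Real.pi * (2 * (j : ℝ) + 1) * (1 / 4 - s / (4 * L)) =
          Real.pi / 2 - (2 * j + 1) * Real.pi / (2 * L) * s + j * Real.pi by field_simp; ring,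
          Real.cos_add_nat_mul_pi, Real.cos_pi_div_two_sub]
      rw [this]
      ring
    · field_simp; ring

section synth

variable {d : ℕ} {Z : Type*} [MeasurableSpace Z]

/-- The superposition `u ↦ ∫ exp (i ⟨p ζ, u⟩) g ζ dζ` of exponentials with frequencies `p ζ`. -/
noncomputable def synth (lam : Measure Z) (p : Z → Rd d) (g : Z → ℂ) (u : Rd d) : ℂ :=
  ∫ ζ, Complex.exp (Complex.I * (inner ℝ (p ζ) u : ℝ)) * g ζ ∂lam

/-- The symbol of the `r`-th directional derivative in direction `h`. -/
noncomputable def lineSym (p : Z → Rd d) (h : Rd d) (r : ℕ) (g : Z → ℂ) (ζ : Z) : ℂ :=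
  (Complex.I * (inner ℝ (p ζ) h : ℝ)) ^ r * g ζ

theorem norm_exp_I_mul_ofReal' (x : ℝ) : ‖Complex.exp (Complex.I * x)‖ = 1 := by
  rw [mul_comm, Complex.norm_exp_ofReal_mul_I]

variable {lam : Measure Z} {p : Z → Rd d} {g : Z → ℂ} {τ : ℝ}

omit [MeasurableSpace Z] in
theorem lineSym_zero (p : Z → Rd d) (h : Rd d) (g : Z → ℂ) : lineSym p h 0 g = g := by
  ext; simp [lineSym]

omit [MeasurableSpace Z] in
theorem lineSym_lineSym (p : Z → Rd d) (h : Rd d) (r s : ℕ) (g : Z → ℂ) :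
    lineSym p h r (lineSym p h s g) = lineSym p h (r + s) g := by
  ext; simp only [lineSym]; ring

theorem norm_lineSym_le (hp : ∀ᵐ ζ ∂lam, ‖p ζ‖ ≤ τ) (h : Rd d) (r : ℕ) :
    ∀ᵐ ζ ∂lam, ‖lineSym p h r g ζ‖ ≤ (τ * ‖h‖) ^ r * ‖g ζ‖ := by
  filter_upwards [hp] with ζ hζ
  rw [lineSym, norm_mul, norm_pow, norm_mul, Complex.norm_I, one_mul, Complex.norm_real]
  gcongr
  exact (norm_inner_le_norm _ _).trans (by gcongr)

theorem aestronglyMeasurable_lineSym (hpm : AEStronglyMeasurable p lam)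
    (hg : AEStronglyMeasurable g lam) (h : Rd d) (r : ℕ) :
    AEStronglyMeasurable (lineSym p h r g) lam := by
  have : AEStronglyMeasurable (fun ζ => inner ℝ (p ζ) h) lam := hpm.inner_const
  exact (((Complex.continuous_ofReal.comp_aestronglyMeasurable this).const_mul _).pow r).mul hg

theorem integrable_lineSym (hpm : AEStronglyMeasurable p lam) (hp : ∀ᵐ ζ ∂lam, ‖p ζ‖ ≤ τ)
    (hg : Integrable g lam) (h : Rd d) (r : ℕ) : Integrable (lineSym p h r g) lam :=
  (hg.norm.const_mul _).mono' (aestronglyMeasurable_lineSym hpm hg.1 h r)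
    (norm_lineSym_le hp h r)

theorem aestronglyMeasurable_exp_inner (hpm : AEStronglyMeasurable p lam) (u : Rd d) :
    AEStronglyMeasurable (fun ζ => Complex.exp (Complex.I * (inner ℝ (p ζ) u : ℝ))) lam := by
  have : AEStronglyMeasurable (fun ζ => inner ℝ (p ζ) u) lam := hpm.inner_const
  exact Complex.continuous_exp.comp_aestronglyMeasurable
    ((Complex.continuous_ofReal.comp_aestronglyMeasurable this).const_mul _)

theorem integrable_exp_inner_mul (hpm : AEStronglyMeasurable p lam) (hg : Integrable g lam)
    (u : Rd d) :
    Integrable (fun ζ => Complex.exp (Complex.I * (inner ℝ (p ζ) u : ℝ)) * g ζ) lam :=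
  hg.norm.mono' ((aestronglyMeasurable_exp_inner hpm u).mul hg.1)
    (Filter.Eventually.of_forall fun ζ => by
      rw [norm_mul, norm_exp_I_mul_ofReal', one_mul])

theorem norm_synth_le (u : Rd d) : ‖synth lam p g u‖ ≤ ∫ ζ, ‖g ζ‖ ∂lam := by
  refine (norm_integral_le_integral_norm _).trans_eq ?_
  congr with ζ
  rw [norm_mul, norm_exp_I_mul_ofReal', one_mul]

theorem hasSum_taylor (hpm : AEStronglyMeasurable p lam) (hp : ∀ᵐ ζ ∂lam, ‖p ζ‖ ≤ τ)
    (hg : Integrable g lam) (u h : Rd d) :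
    HasSum (fun s : ℕ => synth lam p (lineSym p h s g) u / (s.factorial : ℂ))
      (synth lam p g (u + h)) := by
  have hint : ∀ s, synth lam p (lineSym p h s g) u / (s.factorial : ℂ) =
      ∫ ζ, Complex.exp (Complex.I * (inner ℝ (p ζ) u : ℝ)) * lineSym p h s g ζ /
        (s.factorial : ℂ) ∂lam := fun s => by
    rw [synth, integral_div]
  simp_rw [hint]
  refine hasSum_integral_of_dominated_convergence
    (fun s ζ => (τ * ‖h‖) ^ s / s.factorial * ‖g ζ‖) ?_ ?_ ?_ ?_ ?_
  · intro s
    simp_rw [div_eq_mul_inv]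
    exact ((aestronglyMeasurable_exp_inner hpm u).mul
      (aestronglyMeasurable_lineSym hpm hg.1 h s)).mul_const _
  · intro s
    filter_upwards [norm_lineSym_le (g := g) hp h s] with ζ hζ
    rw [norm_div, norm_mul, norm_exp_I_mul_ofReal', one_mul, Complex.norm_natCast,
      div_mul_eq_mul_div]
    gcongr
  · exact Filter.Eventually.of_forall fun ζ =>
      (Real.summable_pow_div_factorial _).mul_right _
  · simp_rw [tsum_mul_right]
    exact hg.norm.const_mul _
  · refine Filter.Eventually.of_forall fun ζ => ?_
    have h1 := (NormedSpace.expSeries_div_hasSum_exp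
      (Complex.I * (inner ℝ (p ζ) h : ℝ))).mul_left
      (Complex.exp (Complex.I * (inner ℝ (p ζ) u : ℝ)) * g ζ)
    rw [← Complex.exp_eq_exp_ℂ, mul_right_comm, ← Complex.exp_add] at h1
    convert! h1 using 1
    · ext s; simp only [lineSym]; ring
    · rw [inner_add_right]; push_cast; ring_nf

theorem norm_synth_lineSym_one_le (hpm : AEStronglyMeasurable p lam)
    (hp : ∀ᵐ ζ ∂lam, ‖p ζ‖ ≤ τ) (hτ : 0 ≤ τ) (hg : Integrable g lam) {M : ℝ}
    (hM : ∀ u, ‖synth lam p g u‖ ≤ M) (u h : Rd d) :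
    ‖synth lam p (lineSym p h 1 g) u‖ ≤ τ * ‖h‖ * M := by
  have hM0 : 0 ≤ M := (norm_nonneg _).trans (hM 0)
  have hs : ∀ᵐ ζ ∂lam, |(inner ℝ (p ζ) h : ℝ)| ≤ τ * ‖h‖ := by
    filter_upwards [hp] with ζ hζ
    exact (abs_real_inner_le_norm _ _).trans (by gcongr)
  rcases lt_or_ge 0 (τ * ‖h‖) with hL | hL
  · obtain ⟨c, t, hc, hct⟩ := exists_sine_series hL
    have hcs : HasSum (fun j => (c j : ℂ) *
        ((synth lam p g (u + t j • h) - synth lam p g (u - t j • h)) / 2))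
        (synth lam p (lineSym p h 1 g) u) := by
      have hint : ∀ j, (c j : ℂ) *
          ((synth lam p g (u + t j • h) - synth lam p g (u - t j • h)) / 2) =
          ∫ ζ, (c j : ℂ) * (Complex.exp (Complex.I * (inner ℝ (p ζ) u : ℝ)) *
            (Complex.I * Real.sin (t j * inner ℝ (p ζ) h)) * g ζ) ∂lam := fun j => by
        rw [integral_const_mul, synth, synth, ← integral_sub
          (integrable_exp_inner_mul hpm hg _) (integrable_exp_inner_mul hpm hg _),
          ← integral_div]
        congr 2 with ζ
        rw [inner_add_right, inner_sub_right, inner_smul_right, Complex.ofReal_sin, Complex.sin]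
        push_cast
        rw [mul_add, mul_sub, Complex.exp_add, Complex.exp_sub,
          show -((t j : ℂ) * ((inner ℝ (p ζ) h : ℝ) : ℂ)) * Complex.I =
            -(Complex.I * (t j * ((inner ℝ (p ζ) h : ℝ) : ℂ))) by ring, Complex.exp_neg,
          show ((t j : ℂ) * ((inner ℝ (p ζ) h : ℝ) : ℂ)) * Complex.I =
            (Complex.I * (t j * ((inner ℝ (p ζ) h : ℝ) : ℂ))) by ring]
        have hI := Complex.I_mul_I
        linear_combination (-(1 / 2 : ℂ)) * Complex.exp (Complex.I * (inner ℝ (p ζ) u : ℝ)) *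
          g ζ * ((Complex.exp (Complex.I * (t j * ((inner ℝ (p ζ) h : ℝ) : ℂ))))⁻¹ -
            Complex.exp (Complex.I * (t j * ((inner ℝ (p ζ) h : ℝ) : ℂ)))) * hI
      simp_rw [hint]
      refine hasSum_integral_of_dominated_convergence (fun j ζ => |c j| * ‖g ζ‖) ?_ ?_ ?_ ?_ ?_
      · intro j
        have h1 : AEStronglyMeasurable (fun ζ => inner ℝ (p ζ) h) lam := hpm.inner_const
        have h2 : AEStronglyMeasurable
            (fun ζ => ((Real.sin (t j * inner ℝ (p ζ) h) : ℝ) : ℂ)) lam :=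
          (Complex.continuous_ofReal.comp (Real.continuous_sin.comp
            (continuous_const.mul continuous_id))).comp_aestronglyMeasurable h1
        exact (((aestronglyMeasurable_exp_inner hpm u).mul (h2.const_mul _)).mul hg.1).const_mul _
      · intro j
        refine Filter.Eventually.of_forall fun ζ => ?_
        rw [norm_mul, norm_mul, norm_mul, norm_mul, norm_exp_I_mul_ofReal', Complex.norm_I,
          Complex.norm_real, Complex.norm_real, one_mul, one_mul, Real.norm_eq_abs,
          Real.norm_eq_abs]
        gcongr
        exact mul_le_of_le_one_left (norm_nonneg _) (Real.abs_sin_le_one _)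
      · exact Filter.Eventually.of_forall fun ζ => hc.summable.mul_right _
      · simp_rw [tsum_mul_right]
        exact hg.norm.const_mul _
      · filter_upwards [hs] with ζ hζ
        have h1 := (Complex.hasSum_ofReal.mpr (hct _ hζ)).mul_left
          (Complex.exp (Complex.I * (inner ℝ (p ζ) u : ℝ)) * Complex.I * g ζ)
        convert! h1 using 1
        · ext j; push_cast; ring
        · simp only [lineSym]; ring
    rw [← hcs.tsum_eq]
    refine tsum_of_norm_bounded (hc.mul_right M) fun j => ?_
    rw [norm_mul, Complex.norm_real, Real.norm_eq_abs, norm_div, Complex.norm_ofNat]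
    gcongr
    rw [div_le_iff₀ two_pos]
    exact (norm_sub_le _ _).trans (by linarith [hM (u + t j • h), hM (u - t j • h)])
  · have h0 : synth lam p (lineSym p h 1 g) u = 0 := by
      refine integral_eq_zero_of_ae ?_
      filter_upwards [hs] with ζ hζ
      have : (inner ℝ (p ζ) h : ℝ) = 0 := abs_nonpos_iff.mp (hζ.trans hL)
      simp [lineSym, this]
    rw [h0, norm_zero]; positivity

theorem norm_synth_lineSym_le (hpm : AEStronglyMeasurable p lam)
    (hp : ∀ᵐ ζ ∂lam, ‖p ζ‖ ≤ τ) (hτ : 0 ≤ τ) (hg : Integrable g lam) {M : ℝ}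
    (hM : ∀ u, ‖synth lam p g u‖ ≤ M) (h : Rd d) (r : ℕ) (u : Rd d) :
    ‖synth lam p (lineSym p h r g) u‖ ≤ (τ * ‖h‖) ^ r * M := by
  induction r generalizing u with
  | zero => rw [lineSym_zero, pow_zero, one_mul]; exact hM u
  | succ r ih =>
    rw [add_comm, ← lineSym_lineSym, pow_add, pow_one, mul_assoc]
    exact norm_synth_lineSym_one_le hpm hp hτ (integrable_lineSym hpm hp hg h r) ih u h

/-- The Taylor polynomial of degree `k` of `synth lam p g` at `u`, evaluated at `u + h`. -/
noncomputable def taylorSum (lam : Measure Z) (p : Z → Rd d) (g : Z → ℂ) (k : ℕ) (u h : Rd d) :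
    ℂ :=
  ∑ r ∈ Finset.range (k + 1), synth lam p (lineSym p h r g) u / (r.factorial : ℂ)

theorem hasSum_sub_taylorSum (hpm : AEStronglyMeasurable p lam)
    (hp : ∀ᵐ ζ ∂lam, ‖p ζ‖ ≤ τ) (hg : Integrable g lam) (k : ℕ) (u h : Rd d) :
    HasSum (fun s : ℕ => synth lam p (lineSym p h (s + (k + 1)) g) u /
      ((s + (k + 1)).factorial : ℂ)) (synth lam p g (u + h) - taylorSum lam p g k u h) := by
  rw [taylorSum, hasSum_nat_add_iff'
    (f := fun s : ℕ => synth lam p (lineSym p h s g) u / (s.factorial : ℂ)) (k + 1)]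
  exact hasSum_taylor hpm hp hg u h

theorem norm_sub_taylorSum_le (hpm : AEStronglyMeasurable p lam)
    (hp : ∀ᵐ ζ ∂lam, ‖p ζ‖ ≤ τ) (hτ : 0 ≤ τ) (hg : Integrable g lam) {M : ℝ}
    (hM : ∀ u, ‖synth lam p g u‖ ≤ M) (k : ℕ) (u h : Rd d) :
    ‖synth lam p g (u + h) - taylorSum lam p g k u h‖ ≤ expRemainder k (τ * ‖h‖) * M := by
  rw [← (hasSum_sub_taylorSum hpm hp hg k u h).tsum_eq]
  refine tsum_of_norm_bounded ((hasSum_expRemainder k (τ * ‖h‖)).mul_right M) fun s => ?_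
  rw [norm_div, Complex.norm_natCast, div_mul_eq_mul_div]
  gcongr
  exact norm_synth_lineSym_le hpm hp hτ hg hM h _ u

end synth

section fourier

variable {d : ℕ}

theorem flip_neg_innerₗ : (-innerₗ (Rd d)).flip = -innerₗ (Rd d) := by
  ext1 x
  intro y
  simp [real_inner_comm]

theorem continuous_uncurry_neg_innerₗ :
    Continuous fun p : Rd d × Rd d => (-innerₗ (Rd d)) p.1 p.2 := by
  simp only [LinearMap.neg_apply, innerₗ_apply_apply]
  fun_prop

theorem integral_schwartz_fourierInv_mul {g : Rd d → ℂ} (hg : Integrable g)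
    (φ : SchwartzMap (Rd d) ℂ) :
    ∫ x, (𝓕⁻ φ : SchwartzMap (Rd d) ℂ) x • g x = ∫ x, φ x • (𝓕⁻ g : Rd d → ℂ) x := by
  have h := VectorFourier.integral_fourierIntegral_smul_eq_flip (μ := volume) (ν := volume)
    (L := -innerₗ (Rd d)) Real.continuous_fourierChar continuous_uncurry_neg_innerₗ
    φ.integrable hg
  rw [flip_neg_innerₗ] at h
  rw [SchwartzMap.fourierInv_coe]
  exact h

theorem continuous_fourierInv_fun {g : Rd d → ℂ} (hg : Integrable g) :
    Continuous (𝓕⁻ g : Rd d → ℂ) :=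
  VectorFourier.fourierIntegral_continuous (L := -innerₗ (Rd d)) Real.continuous_fourierChar
    continuous_uncurry_neg_innerₗ hg

/-- On `L¹ ∩ L²` the inverse Fourier transform of `L²` is given by the integral. -/
theorem fourierInv_toLp_ae_eq {g : Rd d → ℂ} (hg : Integrable g) (hg2 : MemLp g 2) :
    ((𝓕⁻ (hg2.toLp g : L2 d) : L2 d) : Rd d → ℂ) =ᵐ[volume] (𝓕⁻ g : Rd d → ℂ) := by
  refine ae_eq_of_integral_contDiff_smul_eq
    ((Lp.memLp (𝓕⁻ (hg2.toLp g : L2 d) : L2 d)).locallyIntegrable (by norm_num))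
    (continuous_fourierInv_fun hg).locallyIntegrable fun φ hφ hφc => ?_
  have hg₁ : HasCompactSupport (Complex.ofRealCLM ∘ φ) := hφc.comp_left rfl
  have hg₂ : ContDiff ℝ (⊤ : ℕ∞) (Complex.ofRealCLM ∘ φ) := by fun_prop
  set ψ := hg₁.toSchwartzMap hg₂ with hψ
  have hψx : ∀ x, ψ x = (φ x : ℂ) := fun x => rfl
  have h1 := congrArg (fun T => T ψ)
    (Lp.fourierInv_toTemperedDistribution_eq (hg2.toLp g : L2 d))
  simp only [TemperedDistribution.fourierInv_apply, Lp.toTemperedDistribution_apply] at h1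
  have h2 : ∫ x, (𝓕⁻ ψ : SchwartzMap (Rd d) ℂ) x • (hg2.toLp g : L2 d) x =
      ∫ x, (𝓕⁻ ψ : SchwartzMap (Rd d) ℂ) x • g x :=
    integral_congr_ae (by filter_upwards [hg2.coeFn_toLp] with x hx; rw [hx])
  rw [h2, integral_schwartz_fourierInv_mul hg] at h1
  simp only [hψx] at h1
  simpa using h1.symm

/-- The dilation `ξ ↦ 2πξ`. -/
noncomputable def freq (ξ : Rd d) : Rd d := (2 * Real.pi) • ξ

theorem continuous_freq : Continuous (freq : Rd d → Rd d) := continuous_const_smul _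

theorem synth_freq_restrict {S : Set (Rd d)} (hS : MeasurableSet S) (g : Rd d → ℂ) :
    synth (volume.restrict S) freq g = (𝓕⁻ (S.indicator g) : Rd d → ℂ) := by
  ext u
  rw [Real.fourierInv_eq', synth, ← integral_indicator hS]
  congr with ξ
  by_cases h : ξ ∈ S
  · rw [Set.indicator_of_mem h, Set.indicator_of_mem h, freq, inner_smul_left, smul_eq_mul]
    congr 2
    simp [mul_comm]
  · rw [Set.indicator_of_notMem h, Set.indicator_of_notMem h, smul_zero]

theorem enorm_sq_eq_lintegral (f : L2 d) :
    ENNReal.ofReal (‖f‖ ^ 2) = ∫⁻ x, ‖(f : Rd d → ℂ) x‖ₑ ^ 2 := by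
  have h := eLpNorm_nnreal_pow_eq_lintegral (p := 2) (f := (f : Rd d → ℂ)) (μ := volume)
    two_ne_zero
  rw [ENNReal.ofReal_pow (norm_nonneg _), Lp.norm_def, ENNReal.ofReal_toReal (Lp.eLpNorm_ne_top f)]
  simpa using h

variable {S : Set (Rd d)} {g : Rd d → ℂ}

theorem integrable_of_memLp_two (hS : volume S ≠ ⊤) (hg : MemLp g 2 (volume.restrict S)) :
    Integrable g (volume.restrict S) := by
  have : IsFiniteMeasure (volume.restrict S) := isFiniteMeasure_restrict.mpr hS
  exact hg.integrable (by norm_num)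

theorem synth_ae_eq_fourierInv (hSm : MeasurableSet S) (hS : volume S ≠ ⊤)
    (hg : MemLp g 2 (volume.restrict S)) :
    ((𝓕⁻ (((memLp_indicator_iff_restrict hSm).mpr hg).toLp (S.indicator g) : L2 d) : L2 d) :
      Rd d → ℂ) =ᵐ[volume] synth (volume.restrict S) freq g := by
  rw [synth_freq_restrict hSm]
  exact fourierInv_toLp_ae_eq ((integrable_indicator_iff hSm).mpr (integrable_of_memLp_two hS hg)) _

theorem norm_fourierInv_L2 (f : L2 d) : ‖(𝓕⁻ f : L2 d)‖ = ‖f‖ :=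
  (Lp.fourierTransformₗᵢ (Rd d) ℂ).symm.norm_map f

/-- Plancherel's identity. -/
theorem lintegral_synth_sq (hSm : MeasurableSet S) (hS : volume S ≠ ⊤)
    (hg : MemLp g 2 (volume.restrict S)) :
    ∫⁻ u, ‖synth (volume.restrict S) freq g u‖ₑ ^ 2 = ∫⁻ ξ in S, ‖g ξ‖ₑ ^ 2 := by
  have hg' := (memLp_indicator_iff_restrict hSm).mpr hg
  have h1 : ∫⁻ u, ‖synth (volume.restrict S) freq g u‖ₑ ^ 2 =
      ENNReal.ofReal (‖(hg'.toLp _ : L2 d)‖ ^ 2) := by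
    rw [← norm_fourierInv_L2, enorm_sq_eq_lintegral]
    refine lintegral_congr_ae ?_
    filter_upwards [synth_ae_eq_fourierInv hSm hS hg] with u hu
    rw [hu]
  rw [h1, enorm_sq_eq_lintegral, ← lintegral_indicator hSm]
  refine lintegral_congr_ae ?_
  filter_upwards [hg'.coeFn_toLp] with ξ hξ
  rw [hξ]
  by_cases h : ξ ∈ S <;> simp [h]

/-- The set `Ω / 2π`. -/
def scaledBand (Ω : Set (Rd d)) : Set (Rd d) := freq ⁻¹' Ω

variable {Ω : Set (Rd d)}

theorem measurableSet_scaledBand (hΩ : IsCompact Ω) : MeasurableSet (scaledBand Ω) :=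
  (hΩ.isClosed.preimage continuous_freq).measurableSet

theorem volume_scaledBand_ne_top (hΩ : IsCompact Ω) : volume (scaledBand Ω) ≠ ⊤ := by
  have h2 : (2 * Real.pi) ≠ 0 := by positivity
  have : IsCompact (scaledBand Ω) := by
    have h3 := (Homeomorph.smulOfNeZero (2 * Real.pi) h2 (α := Rd d)).isCompact_preimage.mpr hΩ
    exact h3
  exact this.measure_lt_top.ne

theorem exists_spectrum (hΩ : IsCompact Ω) (f : bandlimited Ω) :
    ∃ G : Rd d → ℂ, MemLp G 2 (volume.restrict (scaledBand Ω)) ∧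
      ((f : L2 d) : Rd d → ℂ) =ᵐ[volume] synth (volume.restrict (scaledBand Ω)) freq G ∧
      ∫⁻ ξ in scaledBand Ω, ‖G ξ‖ₑ ^ 2 = ENNReal.ofReal (‖f‖ ^ 2) ∧
      ∀ e : L2 d, inner ℂ (𝓕⁻ e : L2 d) (f : L2 d) =
        ∫ ξ in scaledBand Ω, (starRingEnd ℂ) (e ξ) * G ξ := by
  have hSm := measurableSet_scaledBand hΩ
  have hG : MemLp (𝓕 (f : L2 d) : L2 d) 2 (volume.restrict (scaledBand Ω)) :=
    (Lp.memLp _).restrict _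
  have hf : ((scaledBand Ω).indicator (𝓕 (f : L2 d) : L2 d) : Rd d → ℂ) =ᵐ[volume]
      (𝓕 (f : L2 d) : L2 d) := by
    filter_upwards [f.2] with ξ hξ
    by_cases h : ξ ∈ scaledBand Ω
    · rw [Set.indicator_of_mem h]
    · rw [Set.indicator_of_notMem h, hξ h]
  have hlp : ((memLp_indicator_iff_restrict hSm).mpr hG).toLp _ = (𝓕 (f : L2 d) : L2 d) :=
    Lp.ext (((memLp_indicator_iff_restrict hSm).mpr hG).coeFn_toLp.trans hf)
  have hinv : (𝓕⁻ (𝓕 (f : L2 d) : L2 d) : L2 d) = f := fourierInv_fourier_eq _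
  refine ⟨(𝓕 (f : L2 d) : L2 d), hG, ?_, ?_, fun e => ?_⟩
  · have h := synth_ae_eq_fourierInv hSm (volume_scaledBand_ne_top hΩ) hG
    rw [hlp, hinv] at h
    exact h
  · rw [← lintegral_indicator hSm]
    have : ‖f‖ = ‖(𝓕 (f : L2 d) : L2 d)‖ := (Lp.norm_fourier_eq _).symm
    rw [this, enorm_sq_eq_lintegral]
    refine lintegral_congr_ae ?_
    filter_upwards [hf] with ξ hξ
    conv_rhs => rw [← hξ]
    by_cases h : ξ ∈ scaledBand Ω <;> simp [h]
  · conv_lhs => rw [← hinv]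
    have h1 : inner ℂ (𝓕⁻ e : L2 d) (𝓕⁻ (𝓕 (f : L2 d) : L2 d) : L2 d) =
        inner ℂ e (𝓕 (f : L2 d) : L2 d) :=
      (Lp.fourierTransformₗᵢ (Rd d) ℂ).symm.inner_map_map _ _
    rw [h1, L2.inner_def, ← integral_indicator hSm]
    refine integral_congr_ae ?_
    filter_upwards [hf] with ξ hξ
    rw [← hξ]
    by_cases h : ξ ∈ scaledBand Ω
    · simp [h, mul_comm]
    · simp [h]

end fourier

section derivatives

variable {d : ℕ} {Z : Type*} [MeasurableSpace Z]

/-- The symbol of the partial derivative `D^α`. -/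
noncomputable def monoSym (p : Z → Rd d) (α : Fin d → ℕ) (g : Z → ℂ) (ζ : Z) : ℂ :=
  (∏ i, (Complex.I * (p ζ i : ℝ)) ^ α i) * g ζ

variable {lam : Measure Z} {p : Z → Rd d} {g : Z → ℂ} {τ : ℝ}

theorem abs_coord_le_norm (x : Rd d) (i : Fin d) : |x i| ≤ ‖x‖ := by
  simpa using PiLp.norm_apply_le x i

theorem aestronglyMeasurable_coord (hpm : AEStronglyMeasurable p lam) (i : Fin d) :
    AEStronglyMeasurable (fun ζ => Complex.I * ((p ζ i : ℝ) : ℂ)) lam := by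
  have h : Continuous fun x : Rd d => Complex.I * ((x i : ℝ) : ℂ) := by fun_prop
  exact h.comp_aestronglyMeasurable hpm

theorem norm_monoSym_le (hp : ∀ᵐ ζ ∂lam, ‖p ζ‖ ≤ τ) (α : Fin d → ℕ) :
    ∀ᵐ ζ ∂lam, ‖monoSym p α g ζ‖ ≤ (∏ i, τ ^ α i) * ‖g ζ‖ := by
  filter_upwards [hp] with ζ hζ
  rw [monoSym, norm_mul, norm_prod]
  gcongr with i
  rw [norm_pow, norm_mul, Complex.norm_I, one_mul, Complex.norm_real, Real.norm_eq_abs]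
  gcongr
  exact (abs_coord_le_norm _ _).trans hζ

theorem aestronglyMeasurable_monoSym (hpm : AEStronglyMeasurable p lam)
    (hg : AEStronglyMeasurable g lam) (α : Fin d → ℕ) :
    AEStronglyMeasurable (monoSym p α g) lam :=
  (Finset.aestronglyMeasurable_fun_prod _ fun i _ =>
    (aestronglyMeasurable_coord hpm i).pow (α i)).mul hg

theorem integrable_monoSym (hpm : AEStronglyMeasurable p lam) (hp : ∀ᵐ ζ ∂lam, ‖p ζ‖ ≤ τ)
    (hg : Integrable g lam) (α : Fin d → ℕ) : Integrable (monoSym p α g) lam :=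
  (hg.norm.const_mul _).mono' (aestronglyMeasurable_monoSym hpm hg.1 α) (norm_monoSym_le hp α)

theorem memLp_monoSym (hpm : AEStronglyMeasurable p lam) (hp : ∀ᵐ ζ ∂lam, ‖p ζ‖ ≤ τ)
    (hg : MemLp g 2 lam) (α : Fin d → ℕ) : MemLp (monoSym p α g) 2 lam :=
  hg.of_le_mul (aestronglyMeasurable_monoSym hpm hg.1 α) (norm_monoSym_le hp α)

theorem integrable_coord_mul (hpm : AEStronglyMeasurable p lam) (hp : ∀ᵐ ζ ∂lam, ‖p ζ‖ ≤ τ)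
    (hg : Integrable g lam) (i : Fin d) :
    Integrable (fun ζ => Complex.I * ((p ζ i : ℝ) : ℂ) * g ζ) lam := by
  refine (hg.norm.const_mul τ).mono' ((aestronglyMeasurable_coord hpm i).mul hg.1) ?_
  filter_upwards [hp] with ζ hζ
  rw [norm_mul, norm_mul, Complex.norm_I, one_mul, Complex.norm_real, Real.norm_eq_abs]
  gcongr
  exact (abs_coord_le_norm _ _).trans hζ

theorem coordDeriv_synth (hpm : AEStronglyMeasurable p lam) (hp : ∀ᵐ ζ ∂lam, ‖p ζ‖ ≤ τ)
    (hg : Integrable g lam) (i : Fin d) :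
    coordDeriv i (synth lam p g) =
      synth lam p (fun ζ => Complex.I * ((p ζ i : ℝ) : ℂ) * g ζ) := by
  ext u
  let ℓ : Z → Rd d →L[ℝ] ℂ := fun ζ => Complex.ofRealCLM.comp (innerSL ℝ (p ζ))
  let F' : Rd d → Z → Rd d →L[ℝ] ℂ := fun v ζ =>
    (Complex.exp (Complex.I * (inner ℝ (p ζ) v : ℝ)) * Complex.I * g ζ) • ℓ ζ
  have hℓ : AEStronglyMeasurable ℓ lam := by
    have : Continuous fun x : Rd d => Complex.ofRealCLM.comp (innerSL ℝ x) := by fun_prop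
    exact this.comp_aestronglyMeasurable hpm
  have hF' : AEStronglyMeasurable (F' u) lam :=
    (((aestronglyMeasurable_exp_inner hpm u).mul_const _).mul hg.1).smul hℓ
  have hbound : ∀ᵐ ζ ∂lam, ∀ v ∈ (Set.univ : Set (Rd d)), ‖F' v ζ‖ ≤ ‖g ζ‖ * τ := by
    filter_upwards [hp] with ζ hζ v _
    rw [norm_smul, norm_mul, norm_mul, norm_exp_I_mul_ofReal', Complex.norm_I, one_mul, one_mul]
    gcongr
    refine (ContinuousLinearMap.opNorm_comp_le _ _).trans ?_
    rw [innerSL_apply_norm, Complex.ofRealCLM_norm, one_mul]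
    exact hζ
  have hd : HasFDerivAt (synth lam p g) (∫ ζ, F' u ζ ∂lam) u := by
    refine hasFDerivAt_integral_of_dominated_of_fderiv_le
      (F := fun v ζ => Complex.exp (Complex.I * (inner ℝ (p ζ) v : ℝ)) * g ζ)
      (bound := fun ζ => ‖g ζ‖ * τ) (F' := F') Filter.univ_mem
      (Filter.Eventually.of_forall fun v => (integrable_exp_inner_mul hpm hg v).1)
      (integrable_exp_inner_mul hpm hg u) hF' hbound (hg.norm.mul_const τ) ?_
    refine Filter.Eventually.of_forall fun ζ v _ => ?_
    have h1 : HasFDerivAt (fun v : Rd d => Complex.I * ((inner ℝ (p ζ) v : ℝ) : ℂ))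
        (Complex.I • ℓ ζ) v := (ℓ ζ).hasFDerivAt.const_mul Complex.I
    convert! (h1.cexp).mul_const (g ζ) using 1
    simp only [F', smul_smul]
    congr 1
    ring
  have hint : Integrable (F' u) lam :=
    (hg.norm.mul_const τ).mono' hF' (hbound.mono fun ζ h => h u trivial)
  rw [coordDeriv, hd.fderiv, ContinuousLinearMap.integral_apply hint, synth]
  congr with ζ
  simp only [F', ℓ, smul_apply, ContinuousLinearMap.comp_apply,
    innerSL_apply_apply, Complex.ofRealCLM_apply, smul_eq_mul, EuclideanSpace.inner_single_right]
  simp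
  ring

theorem multiDeriv_synth (hpm : AEStronglyMeasurable p lam) (hp : ∀ᵐ ζ ∂lam, ‖p ζ‖ ≤ τ)
    (hg : Integrable g lam) (α : Fin d → ℕ) :
    multiDeriv α (synth lam p g) = synth lam p (monoSym p α g) := by
  have hiter : ∀ (i : Fin d) (n : ℕ) (g' : Z → ℂ), Integrable g' lam →
      (coordDeriv i)^[n] (synth lam p g') =
        synth lam p (fun ζ => (Complex.I * ((p ζ i : ℝ) : ℂ)) ^ n * g' ζ) ∧
      Integrable (fun ζ => (Complex.I * ((p ζ i : ℝ) : ℂ)) ^ n * g' ζ) lam := by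
    intro i n g' hg'
    induction n with
    | zero => simpa using hg'
    | succ n ih =>
      rw [Function.iterate_succ_apply', ih.1, coordDeriv_synth hpm hp ih.2]
      simp_rw [pow_succ', mul_assoc]
      refine ⟨trivial, ?_⟩
      have := integrable_coord_mul hpm hp ih.2 i
      simpa only [mul_assoc] using this
  have hlist : ∀ l : List (Fin d),
      l.foldr (fun i g => (coordDeriv i)^[α i] g) (synth lam p g) =
        synth lam p (fun ζ => (l.map fun i => (Complex.I * ((p ζ i : ℝ) : ℂ)) ^ α i).prod * g ζ) ∧
      Integrable (fun ζ => (l.map fun i => (Complex.I * ((p ζ i : ℝ) : ℂ)) ^ α i).prod * g ζ)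
        lam := by
    intro l
    induction l with
    | nil => simpa using hg
    | cons i l ih =>
      rw [List.foldr_cons, ih.1]
      have := hiter i (α i) _ ih.2
      simpa only [List.map_cons, List.prod_cons, mul_assoc] using this
  rw [multiDeriv, (hlist _).1]
  congr with ζ

end derivatives

section dual

variable {d : ℕ} {Ω : Set (Rd d)}

theorem bandKernel_eq_synth (hΩ : IsCompact Ω) :
    bandKernel Ω = synth (volume.restrict (scaledBand Ω)) freq (fun _ => 1) := by
  ext u
  have h := Measure.integral_comp_smul (volume : Measure (Rd d))
    (Ω.indicator fun ω => Complex.exp (Complex.I * (inner ℝ ω u : ℝ))) (2 * Real.pi)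
  rw [integral_indicator hΩ.measurableSet, finrank_euclideanSpace_fin,
    abs_of_pos (by positivity), Complex.real_smul] at h
  rw [bandKernel, synth, one_div, ← h, ← integral_indicator (measurableSet_scaledBand hΩ)]
  congr with ξ
  by_cases hξ : ξ ∈ scaledBand Ω
  · rw [Set.indicator_of_mem hξ, Set.indicator_of_mem (show (2 * Real.pi) • ξ ∈ Ω from hξ), mul_one,
      freq]
  · rw [Set.indicator_of_notMem hξ, Set.indicator_of_notMem (show (2 * Real.pi) • ξ ∉ Ω from hξ)]

theorem norm_freq_le {m : ℝ} (hΩ : IsCompact Ω) (hm : ∀ ω ∈ Ω, ‖ω‖ ≤ m) :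
    ∀ᵐ ξ ∂(volume.restrict (scaledBand Ω)), ‖freq ξ‖ ≤ m :=
  (ae_restrict_iff' (measurableSet_scaledBand hΩ)).mpr
    (Filter.Eventually.of_forall fun _ hξ => hm _ hξ)

theorem exists_dual (hΩ : IsCompact Ω) (a : ℝ) (α : Fin d → ℕ) (x : Rd d) :
    ∃ ψ : bandlimited Ω,
      (((ψ : L2 d) : Rd d → ℂ) =ᵐ[volume] fun y =>
        (a : ℂ) * multiDeriv α (bandKernel Ω) (y - x)) ∧
      ∀ (f : bandlimited Ω) (G : Rd d → ℂ),
        (∀ e : L2 d, inner ℂ (𝓕⁻ e : L2 d) (f : L2 d) =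
          ∫ ξ in scaledBand Ω, (starRingEnd ℂ) (e ξ) * G ξ) →
        ‖inner ℂ ψ f‖ =
          |a| * ‖synth (volume.restrict (scaledBand Ω)) freq (monoSym freq α G) x‖ := by
  obtain ⟨m, hm⟩ := hΩ.isBounded.exists_norm_le
  have hSm := measurableSet_scaledBand hΩ
  have hS := volume_scaledBand_ne_top hΩ
  have : IsFiniteMeasure (volume.restrict (scaledBand Ω)) := isFiniteMeasure_restrict.mpr hS
  have hp := norm_freq_le hΩ hm
  have hpm : AEStronglyMeasurable (freq : Rd d → Rd d) (volume.restrict (scaledBand Ω)) :=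
    continuous_freq.aestronglyMeasurable
  have h1 : MemLp (fun _ : Rd d => (1 : ℂ)) 2 (volume.restrict (scaledBand Ω)) := memLp_const 1
  have h1' := h1.integrable (by norm_num)
  have hM := memLp_monoSym hpm hp h1 α
  set E : Rd d → ℂ := fun ξ => (a : ℂ) *
    (Complex.exp (Complex.I * (inner ℝ (freq ξ) (-x) : ℝ)) * monoSym freq α (fun _ => 1) ξ) with hE
  have hEL : MemLp E 2 (volume.restrict (scaledBand Ω)) := by
    refine hM.of_le_mul (c := |a|) (((aestronglyMeasurable_exp_inner hpm (-x)).mul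
      (aestronglyMeasurable_monoSym hpm h1.1 α)).const_mul _)
      (Filter.Eventually.of_forall fun ξ => ?_)
    rw [hE, norm_mul, norm_mul, norm_exp_I_mul_ofReal', one_mul, Complex.norm_real,
      Real.norm_eq_abs]
  have hEi := (memLp_indicator_iff_restrict hSm).mpr hEL
  have hmem : (𝓕⁻ (hEi.toLp _ : L2 d) : L2 d) ∈ bandlimited Ω := by
    change ∀ᵐ ξ : Rd d, (2 * Real.pi) • ξ ∉ Ω → _
    rw [fourier_fourierInv_eq]
    filter_upwards [hEi.coeFn_toLp] with ξ hξ hn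
    rw [hξ, Set.indicator_of_notMem]
    exact hn
  refine ⟨⟨_, hmem⟩, ?_, fun f G hG => ?_⟩
  · refine (synth_ae_eq_fourierInv hSm hS hEL).trans (Filter.Eventually.of_forall fun y => ?_)
    rw [bandKernel_eq_synth hΩ, multiDeriv_synth hpm hp h1']
    simp only [synth]
    rw [← integral_const_mul]
    congr with ξ
    rw [hE, sub_eq_add_neg, inner_add_right]
    push_cast
    rw [mul_add, Complex.exp_add]
    ring
  · rw [Submodule.coe_inner, hG, synth]
    have h2 : ∫ ξ in scaledBand Ω, (starRingEnd ℂ) ((hEi.toLp _ : L2 d) ξ) * G ξ =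
        ((a : ℂ) * (-1) ^ (∑ i, α i)) * ∫ ξ in scaledBand Ω,
          Complex.exp (Complex.I * (inner ℝ (freq ξ) x : ℝ)) * monoSym freq α G ξ := by
      rw [← integral_const_mul]
      refine setIntegral_congr_ae hSm ?_
      filter_upwards [hEi.coeFn_toLp] with ξ hξ hmemξ
      rw [hξ, Set.indicator_of_mem hmemξ]
      simp only [hE, monoSym, map_mul, map_prod, map_pow, Complex.conj_I, Complex.conj_ofReal,
        ← Complex.exp_conj, inner_neg_right, Complex.ofReal_neg, neg_mul, mul_neg, mul_one, map_neg, neg_neg]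
      have : ∏ i, (-(Complex.I * ((freq ξ i : ℝ) : ℂ))) ^ α i =
          (-1) ^ (∑ i, α i) * ∏ i, (Complex.I * ((freq ξ i : ℝ) : ℂ)) ^ α i := by
        rw [← Finset.prod_pow_eq_pow_sum, ← Finset.prod_mul_distrib]
        congr with i
        rw [neg_pow]
      rw [this]
      ring
    rw [h2, norm_mul, norm_mul, norm_pow, norm_neg, norm_one, one_pow, mul_one, Complex.norm_real,
      Real.norm_eq_abs]

end dual

theorem ENNReal.sq_tsum_mul_mul_le {ι : Type*} (w a b : ι → ENNReal) :
    (∑' i, w i * a i * b i) ^ 2 ≤ (∑' i, w i * a i ^ 2) * ∑' i, w i * b i ^ 2 := by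
  have h2 : ∀ x : ENNReal, (x ^ (1 / 2 : ℝ)) ^ 2 = x := fun x => by
    rw [← ENNReal.rpow_natCast, ← ENNReal.rpow_mul]; norm_num
  have hfin : ∀ s : Finset ι, ∑ i ∈ s, w i * a i * b i ≤
      (∑' i, w i * a i ^ 2) ^ (1 / 2 : ℝ) * (∑' i, w i * b i ^ 2) ^ (1 / 2 : ℝ) := fun s => by
    have h := ENNReal.inner_le_Lp_mul_Lq s (fun i => w i ^ (1 / 2 : ℝ) * a i)
      (fun i => w i ^ (1 / 2 : ℝ) * b i) Real.HolderConjugate.two_two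
    calc ∑ i ∈ s, w i * a i * b i
        = ∑ i ∈ s, w i ^ (1 / 2 : ℝ) * a i * (w i ^ (1 / 2 : ℝ) * b i) := by
          refine Finset.sum_congr rfl fun i _ => ?_
          conv_lhs => rw [← h2 (w i)]
          ring
      _ ≤ _ := h
      _ ≤ _ := by
          simp only [ENNReal.rpow_two, mul_pow, h2]
          gcongr <;> exact ENNReal.sum_le_tsum s
  calc (∑' i, w i * a i * b i) ^ 2
      ≤ ((∑' i, w i * a i ^ 2) ^ (1 / 2 : ℝ) * (∑' i, w i * b i ^ 2) ^ (1 / 2 : ℝ)) ^ 2 := by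
        gcongr
        rw [ENNReal.tsum_eq_iSup_sum]
        exact iSup_le hfin
    _ = _ := by rw [mul_pow, h2, h2]

theorem ENNReal.sq_tsum_mul_le {ι : Type*} (w b : ι → ENNReal) :
    (∑' i, w i * b i) ^ 2 ≤ (∑' i, w i) * ∑' i, w i * b i ^ 2 := by
  simpa using ENNReal.sq_tsum_mul_mul_le w 1 b

theorem ENNReal.sq_sum_mul_mul_le {ι : Type*} (s : Finset ι) (w a b : ι → ENNReal) :
    (∑ i ∈ s, w i * a i * b i) ^ 2 ≤ (∑ i ∈ s, w i * a i ^ 2) * ∑ i ∈ s, w i * b i ^ 2 := by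
  simp only [← Finset.tsum_subtype]
  exact ENNReal.sq_tsum_mul_mul_le (ι := s) (fun i => w i) (fun i => a i) (fun i => b i)

theorem ENNReal.tsum_ofReal_eq {ι : Type*} {f : ι → ℝ} {a : ℝ} (hf : ∀ i, 0 ≤ f i)
    (h : HasSum f a) : ∑' i, ENNReal.ofReal (f i) = ENNReal.ofReal a := by
  rw [← ENNReal.ofReal_tsum_of_nonneg hf h.summable, h.tsum_eq]

theorem enorm_le_tsum_enorm_of_hasSum {ι : Type*} {f : ι → ℂ} {a : ℂ} (h : HasSum f a) :
    ‖a‖ₑ ≤ ∑' i, ‖f i‖ₑ := by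
  rw [← h.tsum_eq]
  exact enorm_tsum_le_tsum_enorm

theorem enorm_finsetProd {ι : Type*} (s : Finset ι) (f : ι → ℂ) :
    ‖∏ i ∈ s, f i‖ₑ = ∏ i ∈ s, ‖f i‖ₑ := by
  simp only [enorm, nnnorm_prod, ENNReal.ofNNReal_finsetProd]

theorem hasSum_pow_div_factorial (t : ℝ) :
    HasSum (fun s : ℕ => t ^ s / (s.factorial : ℝ)) (Real.exp t) := by
  rw [Real.exp_eq_exp_ℝ]
  exact NormedSpace.expSeries_div_hasSum_exp t

section jets

variable {d : ℕ} {S : Set (Rd d)} {g : Rd d → ℂ} {m : ℝ}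

/-- Superposition of the exponentials with frequencies in `2πS`. -/
noncomputable abbrev bandSynth (S : Set (Rd d)) (g : Rd d → ℂ) (u : Rd d) : ℂ :=
  synth (volume.restrict S) freq g u

/-- The multi-indices of order `r`. -/
abbrev multiIndices (d r : ℕ) : Finset (Fin d → ℕ) := Finset.univ.piAntidiag r

/-- The squared norm `∑_{|α| = r} (r! / α!) |D^α f(u)|²` of the `r`-th derivative. -/
noncomputable def jetSq (S : Set (Rd d)) (g : Rd d → ℂ) (r : ℕ) (u : Rd d) : ENNReal :=
  ∑ α ∈ multiIndices d r,
    (Nat.multinomial Finset.univ α : ENNReal) * ‖bandSynth S (monoSym freq α g) u‖ₑ ^ 2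

theorem enorm_sq_eq_sum (x : Rd d) : ‖x‖ₑ ^ 2 = ∑ i, ‖x i‖ₑ ^ 2 := by
  simp only [← ofReal_norm, ← ENNReal.ofReal_pow (norm_nonneg _)]
  rw [EuclideanSpace.real_norm_sq_eq, ENNReal.ofReal_sum_of_nonneg fun i _ => sq_nonneg _]
  simp

theorem sum_multinomial_prod_enorm_sq (x : Rd d) (r : ℕ) :
    ∑ α ∈ multiIndices d r, (Nat.multinomial Finset.univ α : ENNReal) *
      (∏ i, ‖x i‖ₑ ^ α i) ^ 2 = ‖x‖ₑ ^ (2 * r) := by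
  rw [pow_mul, enorm_sq_eq_sum, Finset.sum_pow_eq_sum_piAntidiag]
  refine Finset.sum_congr rfl fun α _ => ?_
  rw [← Finset.prod_pow]
  simp_rw [← pow_mul, mul_comm]

theorem enorm_monoSym {Z : Type*} (p : Z → Rd d) (α : Fin d → ℕ) (g : Z → ℂ) (ζ : Z) :
    ‖monoSym p α g ζ‖ₑ = (∏ i, ‖p ζ i‖ₑ ^ α i) * ‖g ζ‖ₑ := by
  rw [monoSym, enorm_mul, enorm_finsetProd]
  congr 1
  refine Finset.prod_congr rfl fun i _ => ?_
  rw [enorm_pow, enorm_mul]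
  simp [← ofReal_norm]

theorem sum_multinomial_enorm_monoSym_sq (g : Rd d → ℂ) (r : ℕ) (ξ : Rd d) :
    ∑ α ∈ multiIndices d r, (Nat.multinomial Finset.univ α : ENNReal) *
      ‖monoSym freq α g ξ‖ₑ ^ 2 = ‖freq ξ‖ₑ ^ (2 * r) * ‖g ξ‖ₑ ^ 2 := by
  simp_rw [enorm_monoSym, mul_pow, ← mul_assoc]
  rw [← Finset.sum_mul, sum_multinomial_prod_enorm_sq]

theorem aestronglyMeasurable_freq : AEStronglyMeasurable (freq : Rd d → Rd d)
    (volume.restrict S) := continuous_freq.aestronglyMeasurable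

theorem continuous_synth {Z : Type*} [MeasurableSpace Z] {lam : Measure Z} {p : Z → Rd d}
    {g : Z → ℂ} (hpm : AEStronglyMeasurable p lam) (hg : Integrable g lam) :
    Continuous (synth lam p g) := by
  refine continuous_of_dominated (bound := fun ζ => ‖g ζ‖)
    (fun u => (integrable_exp_inner_mul hpm hg u).1)
    (fun u => Filter.Eventually.of_forall fun ζ => ?_) hg.norm
    (Filter.Eventually.of_forall fun ζ => by fun_prop)
  rw [norm_mul, norm_exp_I_mul_ofReal', one_mul]

theorem continuous_bandSynth (hS : volume S ≠ ⊤) (hg : MemLp g 2 (volume.restrict S)) :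
    Continuous (bandSynth S g) :=
  continuous_synth aestronglyMeasurable_freq (integrable_of_memLp_two hS hg)

theorem measurable_enorm_sq_bandSynth (hS : volume S ≠ ⊤) (hg : MemLp g 2 (volume.restrict S)) :
    Measurable fun u => ‖bandSynth S g u‖ₑ ^ 2 :=
  ((continuous_bandSynth hS hg).measurable.enorm).pow_const 2

theorem measurable_jetSq (hS : volume S ≠ ⊤)
    (hp : ∀ᵐ ξ ∂(volume.restrict S), ‖freq ξ‖ ≤ m) (hg : MemLp g 2 (volume.restrict S)) (r : ℕ) :
    Measurable (jetSq S g r) :=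
  Finset.measurable_fun_sum _ fun α _ => (measurable_enorm_sq_bandSynth hS
    (memLp_monoSym aestronglyMeasurable_freq hp hg α)).const_mul _

theorem lintegral_sum_monoSym_le (hp : ∀ᵐ ξ ∂(volume.restrict S), ‖freq ξ‖ ≤ m)
    (hg : MemLp g 2 (volume.restrict S)) (r : ℕ) :
    ∑ α ∈ multiIndices d r, (Nat.multinomial Finset.univ α : ENNReal) *
      ∫⁻ ξ in S, ‖monoSym freq α g ξ‖ₑ ^ 2 ≤
      ENNReal.ofReal m ^ (2 * r) * ∫⁻ ξ in S, ‖g ξ‖ₑ ^ 2 := by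
  have hmeas : ∀ α, AEMeasurable (fun ξ => ‖monoSym freq α g ξ‖ₑ ^ 2) (volume.restrict S) :=
    fun α => ((aestronglyMeasurable_monoSym aestronglyMeasurable_freq hg.1 α).enorm).pow_const 2
  calc _ = ∫⁻ ξ in S, ∑ α ∈ multiIndices d r, (Nat.multinomial Finset.univ α : ENNReal) *
        ‖monoSym freq α g ξ‖ₑ ^ 2 := by
        rw [lintegral_finsetSum' _ fun α _ => (hmeas α).const_mul _]
        exact Finset.sum_congr rfl fun α _ => (lintegral_const_mul'' _ (hmeas α)).symm
    _ ≤ ∫⁻ ξ in S, ENNReal.ofReal m ^ (2 * r) * ‖g ξ‖ₑ ^ 2 := by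
        simp_rw [sum_multinomial_enorm_monoSym_sq]
        refine lintegral_mono_ae ?_
        filter_upwards [hp] with ξ hξ
        gcongr
        rw [← ofReal_norm]
        exact ENNReal.ofReal_le_ofReal hξ
    _ = _ := lintegral_const_mul'' _ (hg.1.enorm.pow_const 2)

theorem lintegral_jetSq_le (hSm : MeasurableSet S) (hS : volume S ≠ ⊤)
    (hp : ∀ᵐ ξ ∂(volume.restrict S), ‖freq ξ‖ ≤ m) (hg : MemLp g 2 (volume.restrict S)) (r : ℕ) :
    ∫⁻ u, jetSq S g r u ≤ ENNReal.ofReal m ^ (2 * r) * ∫⁻ ξ in S, ‖g ξ‖ₑ ^ 2 := by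
  refine le_of_eq_of_le ?_ (lintegral_sum_monoSym_le hp hg r)
  have hL : ∀ α, MemLp (monoSym freq α g) 2 (volume.restrict S) := fun α =>
    memLp_monoSym aestronglyMeasurable_freq hp hg α
  simp only [jetSq]
  rw [lintegral_finsetSum _ fun α _ => (measurable_enorm_sq_bandSynth hS (hL α)).const_mul _]
  refine Finset.sum_congr rfl fun α _ => ?_
  rw [lintegral_const_mul _ (measurable_enorm_sq_bandSynth hS (hL α)),
    lintegral_synth_sq hSm hS (hL α)]

theorem synth_lineSym_eq_sum {Z : Type*} [MeasurableSpace Z] {lam : Measure Z} {p : Z → Rd d}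
    {g : Z → ℂ} (hpm : AEStronglyMeasurable p lam) (hp : ∀ᵐ ζ ∂lam, ‖p ζ‖ ≤ m)
    (hg : Integrable g lam) (h : Rd d) (r : ℕ) (u : Rd d) :
    synth lam p (lineSym p h r g) u = ∑ α ∈ multiIndices d r,
      (Nat.multinomial Finset.univ α : ℂ) * (∏ i, ((h i : ℝ) : ℂ) ^ α i) *
        synth lam p (monoSym p α g) u := by
  simp only [synth]
  simp_rw [← integral_const_mul]
  rw [← integral_finsetSum _ fun α _ =>
    (integrable_exp_inner_mul hpm (integrable_monoSym hpm hp hg α) u).const_mul _]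
  congr with ζ
  have h1 : Complex.I * ((inner ℝ (p ζ) h : ℝ) : ℂ) =
      ∑ i, ((h i : ℝ) : ℂ) * (Complex.I * ((p ζ i : ℝ) : ℂ)) := by
    rw [PiLp.inner_apply, Complex.ofReal_sum, Finset.mul_sum]
    refine Finset.sum_congr rfl fun i _ => ?_
    simp only [RCLike.inner_apply', conj_trivial, Complex.ofReal_mul]
    ring
  rw [lineSym, h1, Finset.sum_pow_eq_sum_piAntidiag, Finset.sum_mul, Finset.mul_sum]
  refine Finset.sum_congr rfl fun α _ => ?_
  simp_rw [monoSym, mul_pow, Finset.prod_mul_distrib]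
  ring

theorem enorm_lineSym_sq_le (hS : volume S ≠ ⊤)
    (hp : ∀ᵐ ξ ∂(volume.restrict S), ‖freq ξ‖ ≤ m) (hg : MemLp g 2 (volume.restrict S))
    (h : Rd d) (r : ℕ) (u : Rd d) :
    ‖bandSynth S (lineSym freq h r g) u‖ₑ ^ 2 ≤ ‖h‖ₑ ^ (2 * r) * jetSq S g r u := by
  rw [bandSynth, synth_lineSym_eq_sum aestronglyMeasurable_freq hp
    (integrable_of_memLp_two hS hg), ← sum_multinomial_prod_enorm_sq, jetSq]
  refine le_trans ?_ (ENNReal.sq_sum_mul_mul_le _ _ _ _)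
  gcongr
  refine (enorm_sum_le _ _).trans (Finset.sum_le_sum fun α _ => ?_)
  rw [enorm_mul, enorm_mul]
  gcongr
  · simp [← ofReal_norm]
  · rw [enorm_finsetProd]
    refine (Finset.prod_congr rfl fun i _ => ?_).le
    simp [← ofReal_norm]

end jets

section majorant

variable {d : ℕ} {S : Set (Rd d)} {g : Rd d → ℂ} {m : ℝ}

theorem enorm_sq_le_of_hasSum_div_factorial {e : ℕ → ℕ} {A : ℕ → ℂ} {a : ℂ} {t R : ℝ} (ht : 0 < t)
    (hR : HasSum (fun s => t ^ e s / ((e s).factorial : ℝ)) R)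
    (h : HasSum (fun s => A s / ((e s).factorial : ℂ)) a) :
    ‖a‖ₑ ^ 2 ≤ ENNReal.ofReal R * ∑' s, ENNReal.ofReal (t ^ e s / ((e s).factorial : ℝ)) *
      (ENNReal.ofReal ((t ^ e s)⁻¹) ^ 2 * ‖A s‖ₑ ^ 2) := by
  rw [← ENNReal.tsum_ofReal_eq (fun s => by positivity) hR]
  simp_rw [← mul_pow]
  refine le_trans ?_ (ENNReal.sq_tsum_mul_le _ _)
  gcongr
  refine (enorm_le_tsum_enorm_of_hasSum h).trans (ENNReal.tsum_le_tsum fun s => ?_)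
  rw [← mul_assoc, ← ENNReal.ofReal_mul (by positivity), ← ofReal_norm, ← ofReal_norm,
    ← ENNReal.ofReal_mul (by positivity), norm_div, Complex.norm_natCast]
  refine ENNReal.ofReal_le_ofReal (le_of_eq ?_)
  field_simp

/-- A majorant of the squared `r`-th derivatives at distance at most `ρ` from `u`. -/
noncomputable def jetMajorant (S : Set (Rd d)) (g : Rd d → ℂ) (t ρ : ℝ) (r : ℕ) (u : Rd d) :
    ENNReal :=
  ENNReal.ofReal (Real.exp t) * ∑' s : ℕ, ENNReal.ofReal (t ^ s / (s.factorial : ℝ)) *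
    (ENNReal.ofReal ((t ^ s)⁻¹) ^ 2 * (ENNReal.ofReal ρ ^ (2 * s) *
      ∑ α ∈ multiIndices d r, (Nat.multinomial Finset.univ α : ENNReal) *
        jetSq S (monoSym freq α g) s u))

theorem jetSq_add_le (hS : volume S ≠ ⊤)
    (hp : ∀ᵐ ξ ∂(volume.restrict S), ‖freq ξ‖ ≤ m) (hg : MemLp g 2 (volume.restrict S))
    {t ρ : ℝ} (ht : 0 < t) (r : ℕ) (u : Rd d) {v : Rd d} (hv : ‖v‖ ≤ ρ) :
    jetSq S g r (u + v) ≤ jetMajorant S g t ρ r u := by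
  have hL : ∀ α, MemLp (monoSym freq α g) 2 (volume.restrict S) := fun α =>
    memLp_monoSym aestronglyMeasurable_freq hp hg α
  have hv' : ‖v‖ₑ ≤ ENNReal.ofReal ρ := by
    rw [← ofReal_norm]; exact ENNReal.ofReal_le_ofReal hv
  have h1 : ∀ α, ‖bandSynth S (monoSym freq α g) (u + v)‖ₑ ^ 2 ≤ ENNReal.ofReal (Real.exp t) *
      ∑' s : ℕ, ENNReal.ofReal (t ^ s / (s.factorial : ℝ)) *
        (ENNReal.ofReal ((t ^ s)⁻¹) ^ 2 * (ENNReal.ofReal ρ ^ (2 * s) *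
          jetSq S (monoSym freq α g) s u)) := fun α => by
    refine (enorm_sq_le_of_hasSum_div_factorial (e := id) ht (hasSum_pow_div_factorial t)
      (hasSum_taylor aestronglyMeasurable_freq hp (integrable_of_memLp_two hS (hL α)) u v)).trans ?_
    simp only [id]
    gcongr with s
    exact (enorm_lineSym_sq_le hS hp (hL α) v s u).trans (by gcongr)
  rw [jetSq, jetMajorant]
  calc _ ≤ ∑ α ∈ multiIndices d r, (Nat.multinomial Finset.univ α : ENNReal) *
        (ENNReal.ofReal (Real.exp t) * ∑' s : ℕ, ENNReal.ofReal (t ^ s / (s.factorial : ℝ)) *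
        (ENNReal.ofReal ((t ^ s)⁻¹) ^ 2 * (ENNReal.ofReal ρ ^ (2 * s) *
          jetSq S (monoSym freq α g) s u))) := by
        gcongr with α _
        exact h1 α
    _ = _ := by
        simp_rw [mul_left_comm _ (ENNReal.ofReal (Real.exp t)), ← Finset.mul_sum]
        congr 1
        simp_rw [← ENNReal.tsum_mul_left]
        rw [← Summable.tsum_finsetSum fun _ _ => ENNReal.summable]
        congr with s
        simp_rw [Finset.mul_sum]
        refine Finset.sum_congr rfl fun α _ => ?_
        ring

theorem measurable_jetMajorant (hS : volume S ≠ ⊤)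
    (hp : ∀ᵐ ξ ∂(volume.restrict S), ‖freq ξ‖ ≤ m) (hg : MemLp g 2 (volume.restrict S))
    (t ρ : ℝ) (r : ℕ) : Measurable (jetMajorant S g t ρ r) := by
  refine (Measurable.tsum fun s => ((Finset.measurable_fun_sum _ fun α _ =>
    (measurable_jetSq hS hp (memLp_monoSym aestronglyMeasurable_freq hp hg α) s).const_mul
      _).const_mul _).const_mul _ |>.const_mul _).const_mul _

theorem tsum_ofReal_weights {t : ℝ} (ht : 0 < t) {e : ℕ → ℕ} {R : ℝ}
    (hR : HasSum (fun s => t ^ e s / ((e s).factorial : ℝ)) R) (E : ENNReal) :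
    ∑' s, ENNReal.ofReal (t ^ e s / ((e s).factorial : ℝ)) *
      (ENNReal.ofReal ((t ^ e s)⁻¹) ^ 2 * (ENNReal.ofReal t ^ (2 * e s) * E)) =
      ENNReal.ofReal R * E := by
  rw [← ENNReal.tsum_ofReal_eq (fun s => by positivity) hR, ← ENNReal.tsum_mul_right]
  congr with s
  have : ENNReal.ofReal ((t ^ e s)⁻¹) ^ 2 * ENNReal.ofReal t ^ (2 * e s) = 1 := by
    rw [mul_comm 2, pow_mul, ← mul_pow, ← ENNReal.ofReal_pow ht.le, ← ENNReal.ofReal_mul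
      (by positivity), inv_mul_cancel₀ (by positivity), ENNReal.ofReal_one, one_pow]
  rw [← mul_assoc (_ ^ 2), this, one_mul]

theorem lintegral_jetMajorant_le (hSm : MeasurableSet S) (hS : volume S ≠ ⊤)
    (hp : ∀ᵐ ξ ∂(volume.restrict S), ‖freq ξ‖ ≤ m) (hg : MemLp g 2 (volume.restrict S))
    {t ρ : ℝ} (ht : 0 < t) (hρ : 0 ≤ ρ) (htρ : t = ρ * m) (r : ℕ) :
    ∫⁻ u, jetMajorant S g t ρ r u ≤ ENNReal.ofReal (Real.exp t) ^ 2 *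
      (ENNReal.ofReal m ^ (2 * r) * ∫⁻ ξ in S, ‖g ξ‖ₑ ^ 2) := by
  have hL : ∀ α, MemLp (monoSym freq α g) 2 (volume.restrict S) := fun α =>
    memLp_monoSym aestronglyMeasurable_freq hp hg α
  have hJ := fun α s => measurable_jetSq hS hp (hL α) s
  have hsum : ∀ s, Measurable fun u => ∑ α ∈ multiIndices d r,
      (Nat.multinomial Finset.univ α : ENNReal) * jetSq S (monoSym freq α g) s u := fun s =>
    Finset.measurable_fun_sum _ fun α _ => (hJ α s).const_mul _
  have hI : ∀ s, ∫⁻ u, ∑ α ∈ multiIndices d r,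
      (Nat.multinomial Finset.univ α : ENNReal) * jetSq S (monoSym freq α g) s u ≤
      ENNReal.ofReal m ^ (2 * s) * (ENNReal.ofReal m ^ (2 * r) * ∫⁻ ξ in S, ‖g ξ‖ₑ ^ 2) := by
    intro s
    rw [lintegral_finsetSum _ fun α _ => (hJ α s).const_mul _]
    calc _ ≤ ∑ α ∈ multiIndices d r, (Nat.multinomial Finset.univ α : ENNReal) *
          (ENNReal.ofReal m ^ (2 * s) * ∫⁻ ξ in S, ‖monoSym freq α g ξ‖ₑ ^ 2) := by
          gcongr with α _
          rw [lintegral_const_mul _ (hJ α s)]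
          gcongr
          exact lintegral_jetSq_le hSm hS hp (hL α) s
      _ ≤ _ := by
          simp_rw [mul_left_comm _ (ENNReal.ofReal m ^ (2 * s)), ← Finset.mul_sum]
          gcongr
          exact lintegral_sum_monoSym_le hp hg r
  simp only [jetMajorant]
  rw [lintegral_const_mul _ (Measurable.tsum fun s => (((hsum s).const_mul _).const_mul
    _).const_mul _), lintegral_tsum fun s => ((((hsum s).const_mul _).const_mul
    _).const_mul _).aemeasurable, sq, mul_assoc]
  gcongr
  rw [← tsum_ofReal_weights (e := id) ht (hasSum_pow_div_factorial t)]
  refine ENNReal.tsum_le_tsum fun s => ?_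
  rw [lintegral_const_mul _ (((hsum s).const_mul _).const_mul _),
    lintegral_const_mul _ ((hsum s).const_mul _), lintegral_const_mul _ (hsum s)]
  simp only [id]
  refine mul_le_mul_right (mul_le_mul_right ?_ _) _
  refine (mul_le_mul_right (hI s) _).trans_eq ?_
  rw [← mul_assoc, ← mul_pow, ← ENNReal.ofReal_mul hρ, htρ]

end majorant

section cells

variable {d : ℕ} {N : Seminorm ℝ (Rd d)}

theorem continuous_seminorm (N : Seminorm ℝ (Rd d)) : Continuous N :=
  N.convexOn.locallyLipschitz.continuous

theorem exists_norm_le_mul (hN : ∀ v, N v = 0 → v = 0) : ∃ b : ℝ, 0 < b ∧ ∀ x, ‖x‖ ≤ b * N x := by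
  rcases (Metric.sphere (0 : Rd d) 1).eq_empty_or_nonempty with h | h
  · refine ⟨1, one_pos, fun x => ?_⟩
    have : x = 0 := by
      by_contra hx
      have : ‖x‖⁻¹ • x ∈ Metric.sphere (0 : Rd d) 1 := by
        simp [norm_smul, norm_ne_zero_iff.mpr hx]
      rw [h] at this
      exact this
    simp [this]
  · obtain ⟨y, hy, hmin⟩ := (isCompact_sphere (0 : Rd d) 1).exists_isMinOn h
      (continuous_seminorm N).continuousOn
    have hy1 : ‖y‖ = 1 := by simpa using hy
    have hy0 : 0 < N y := lt_of_le_of_ne (apply_nonneg N y) fun h0 => by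
      rw [hN y h0.symm, norm_zero] at hy1
      exact zero_ne_one hy1
    refine ⟨(N y)⁻¹, by positivity, fun x => ?_⟩
    by_cases hx : x = 0
    · simp [hx]
    have hx' : 0 < ‖x‖ := norm_pos_iff.mpr hx
    have h1 : N y ≤ N (‖x‖⁻¹ • x) := hmin (by simp [norm_smul, hx'.ne'])
    rw [map_smul_eq_mul, norm_inv, norm_norm, le_inv_mul_iff₀ hx'] at h1
    rw [le_inv_mul_iff₀ hy0, mul_comm]
    exact h1

theorem norm_le_normConst_mul (hN : ∀ v, N v = 0 → v = 0) (x : Rd d) :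
    ‖x‖ ≤ normConst N * N x := by
  by_cases hx : x = 0
  · simp [hx]
  have hx' : 0 < N x := lt_of_le_of_ne (apply_nonneg N x) fun h0 => hx (hN x h0.symm)
  rw [← div_le_iff₀ hx']
  refine le_csInf (exists_norm_le_mul hN) fun b hb => ?_
  rw [div_le_iff₀ hx']
  exact hb.2 x

theorem normConst_pos (hd : 1 ≤ d) (hN : ∀ v, N v = 0 → v = 0) : 0 < normConst N := by
  have h := norm_le_normConst_mul hN (EuclideanSpace.single (⟨0, hd⟩ : Fin d) (1 : ℝ))
  rw [show ‖EuclideanSpace.single (⟨0, hd⟩ : Fin d) (1 : ℝ)‖ = 1 by simp] at h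
  by_contra! h0
  linarith [mul_nonpos_of_nonpos_of_nonneg h0
    (apply_nonneg N (EuclideanSpace.single (⟨0, hd⟩ : Fin d) (1 : ℝ)))]

/-- The sets `V n` partition space up to null sets, and `V n` lies in the ball of radius `δ`
around `x n`. -/
structure IsCellCover {I : Type*} (N : Seminorm ℝ (Rd d)) (x : I → Rd d) (V : I → Set (Rd d))
    (δ : ℝ) : Prop where
  measurableSet : ∀ n, MeasurableSet (V n)
  dist_le : ∀ n, ∀ y ∈ V n, N (y - x n) ≤ δ
  tsum_lintegral : ∀ q : Rd d → ENNReal, ∑' n, ∫⁻ y in V n, q y = ∫⁻ y, q y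

theorem isCellCover_voronoi {I : Type*} [Countable I] {x : I → Rd d}
    (hx : ∀ᵐ y : Rd d, ∃! n, y ∈ voronoiCell N x n) (hδ : sampleGap N x ≠ ⊤) :
    IsCellCover N x (voronoiCell N x) (sampleGap N x).toReal := by
  have hmeas : ∀ n, MeasurableSet (voronoiCell N x n) := fun n => by
    have hN := continuous_seminorm N
    have : IsClosed (voronoiCell N x n) := by
      simp only [voronoiCell, Set.ofPred_forall]
      exact isClosed_iInter fun m => isClosed_iInter fun _ =>
        isClosed_le (by fun_prop) (by fun_prop)
    exact this.measurableSet
  have hx0 : volume {y | ¬ ∃! n, y ∈ voronoiCell N x n} = 0 := ae_iff.mp hx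
  refine ⟨hmeas, fun n y hy => ?_, fun q => ?_⟩
  · rw [← ENNReal.ofReal_le_iff_le_toReal hδ]
    refine le_trans (le_iInf fun m => ?_) (le_iSup (fun y => ⨅ n, ENNReal.ofReal (N (y - x n))) y)
    by_cases h : m = n
    · rw [h]
    · exact ENNReal.ofReal_le_ofReal (hy m h)
  · rw [← lintegral_iUnion₀ (fun n => (hmeas n).nullMeasurableSet)]
    · rw [setLIntegral_congr (t := Set.univ), setLIntegral_univ]
      rw [ae_eq_univ]
      refine measure_mono_null (t := {y | ¬ ∃! n, y ∈ voronoiCell N x n}) (fun y hy h => hy ?_) hx0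
      obtain ⟨n, hn, -⟩ := h
      exact Set.mem_iUnion.mpr ⟨n, hn⟩
    · intro n k hnk
      refine measure_mono_null (t := {y | ¬ ∃! n, y ∈ voronoiCell N x n}) (fun y hy h => hnk ?_) hx0
      exact h.unique hy.1 hy.2

theorem volume_closedBall_seminorm (N : Seminorm ℝ (Rd d)) {r c : ℝ} (hc : 0 < c) :
    volume (N.closedBall 0 (c * r)) = ENNReal.ofReal (c ^ d) * volume (N.closedBall 0 r) := by
  have h := Seminorm.smul_closedBall_zero (p := N) (k := c) (r := r) (by simpa using hc.ne')
  rw [Real.norm_of_nonneg hc.le] at h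
  rw [← h, Measure.addHaar_smul_of_nonneg _ hc.le, finrank_euclideanSpace_fin]

theorem volume_closedBall_seminorm_pos (N : Seminorm ℝ (Rd d)) {r : ℝ} (hr : 0 < r) :
    0 < volume (N.closedBall 0 r) := by
  have hopen : IsOpen {y | N y < r} := isOpen_lt (continuous_seminorm N) continuous_const
  refine (hopen.measure_pos volume ⟨0, by simpa using hr⟩).trans_le (measure_mono fun y hy => ?_)
  rw [Seminorm.mem_closedBall_zero]
  exact le_of_lt hy

theorem volume_closedBall_seminorm_ne_top (hN : ∀ v, N v = 0 → v = 0) (r : ℝ) :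
    volume (N.closedBall 0 r) ≠ ⊤ := by
  obtain ⟨b, hb, hbN⟩ := exists_norm_le_mul hN
  refine ((measure_mono fun y hy => ?_).trans_lt
    (measure_closedBall_lt_top (x := (0 : Rd d)) (r := b * r))).ne
  rw [Seminorm.mem_closedBall_zero] at hy
  rw [mem_closedBall_zero_iff]
  exact (hbN y).trans (by gcongr)

theorem volume_seminorm_sub_le (N : Seminorm ℝ (Rd d)) (a : Rd d) (r : ℝ) :
    volume {y | N (y - a) ≤ r} = volume (N.closedBall 0 r) := by
  have : {y | N (y - a) ≤ r} = (fun y => y + (-a)) ⁻¹' (N.closedBall 0 r) := by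
    ext y
    simp [sub_eq_add_neg]
  rw [this, measure_preimage_add_right]

end cells

section sampling

variable {d : ℕ} {S : Set (Rd d)} {g : Rd d → ℂ} {m : ℝ} {N : Seminorm ℝ (Rd d)}
  {I : Type*} {x : I → Rd d} {V : I → Set (Rd d)} {δ b : ℝ}

theorem tsum_jetSq_le (hSm : MeasurableSet S) (hS : volume S ≠ ⊤)
    (hp : ∀ᵐ ξ ∂(volume.restrict S), ‖freq ξ‖ ≤ m) (hg : MemLp g 2 (volume.restrict S))
    (hV : IsCellCover N x V δ) (hb0 : 0 < b) (hb : ∀ v, ‖v‖ ≤ b * N v) (hδ : 0 < δ) (hm : 0 < m)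
    (r : ℕ) :
    ∑' n, ∫⁻ _ in V n, jetSq S g r (x n) ≤ ENNReal.ofReal (Real.exp (b * δ * m)) ^ 2 *
      (ENNReal.ofReal m ^ (2 * r) * ∫⁻ ξ in S, ‖g ξ‖ₑ ^ 2) := by
  refine le_trans ?_ (lintegral_jetMajorant_le hSm hS hp hg (t := b * δ * m) (ρ := b * δ)
    (by positivity) (by positivity) rfl r)
  rw [← hV.tsum_lintegral]
  refine ENNReal.tsum_le_tsum fun n => setLIntegral_mono_ae
    (measurable_jetMajorant hS hp hg _ _ r).aemeasurable (Filter.Eventually.of_forall fun y hy => ?_)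
  have h := jetSq_add_le hS hp hg (t := b * δ * m) (by positivity) r y (v := x n - y)
    (ρ := b * δ) ?_
  · rwa [add_sub_cancel] at h
  · refine (hb _).trans ?_
    gcongr
    rw [map_sub_rev]
    exact hV.dist_le n y hy

theorem tsum_jetSq_le_of_averaging [Countable I] (hSm : MeasurableSet S) (hS : volume S ≠ ⊤)
    (hp : ∀ᵐ ξ ∂(volume.restrict S), ‖freq ξ‖ ≤ m) (hg : MemLp g 2 (volume.restrict S))
    (hN : ∀ v, N v = 0 → v = 0)
    (hV : IsCellCover N x V δ) (hb0 : 0 < b) (hb : ∀ v, ‖v‖ ≤ b * N v) (hδ : 0 < δ) (hm : 0 < m)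
    {σ : ℝ} (hσ : 0 < σ) (r : ℕ) :
    ∑' n, ∫⁻ _ in V n, jetSq S g r (x n) ≤
      ENNReal.ofReal ((1 + σ) ^ d) * ENNReal.ofReal (Real.exp (b * δ * m / σ)) ^ 2 *
      (ENNReal.ofReal m ^ (2 * r) * ∫⁻ ξ in S, ‖g ξ‖ₑ ^ 2) := by
  have hN' := continuous_seminorm N
  set t := b * δ * m / σ with ht
  have ht0 : 0 < t := by positivity
  set H := jetMajorant S g t (b * (δ / σ)) r with hH
  have hHm : Measurable H := measurable_jetMajorant hS hp hg _ _ r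
  set B : I → Set (Rd d) := fun n => {y | N (y - x n) ≤ δ / σ} with hB
  have hBm : ∀ n, MeasurableSet (B n) := fun n =>
    (isClosed_le (by fun_prop) continuous_const : IsClosed (B n)).measurableSet
  set β := volume (N.closedBall 0 (δ / σ)) with hβ
  have hβ0 : β ≠ 0 := (volume_closedBall_seminorm_pos N (by positivity)).ne'
  have hβt : β ≠ ⊤ := volume_closedBall_seminorm_ne_top hN _
  have hone : ∀ n, β * jetSq S g r (x n) ≤ ∫⁻ y in B n, H y := fun n => by
    have h1 : ∫⁻ _ in B n, jetSq S g r (x n) = β * jetSq S g r (x n) := by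
      rw [setLIntegral_const, hB, volume_seminorm_sub_le, mul_comm]
    rw [← h1]
    refine setLIntegral_mono_ae hHm.aemeasurable (Filter.Eventually.of_forall fun y hy => ?_)
    have h := jetSq_add_le hS hp hg ht0 r y (v := x n - y) (ρ := b * (δ / σ)) ?_
    · rwa [add_sub_cancel] at h
    · refine (hb _).trans ?_
      gcongr
      rw [map_sub_rev]
      exact hy
  have hcount : ∀ y, ∑' n, volume (V n) * (B n).indicator 1 y ≤
      ENNReal.ofReal ((1 + σ) ^ d) * β := fun y => by
    have hle : ∀ n, volume (V n) * (B n).indicator 1 y ≤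
        ∫⁻ w in V n, {w | N (w - y) ≤ (1 + σ) * (δ / σ)}.indicator 1 w := fun n => by
      by_cases hy : y ∈ B n
      · rw [Set.indicator_of_mem hy, Pi.one_apply, mul_one, ← setLIntegral_one]
        refine setLIntegral_mono_ae ((measurable_one.indicator
          (isClosed_le (by fun_prop) continuous_const :
            IsClosed {w | N (w - y) ≤ (1 + σ) * (δ / σ)}).measurableSet).aemeasurable)
          (Filter.Eventually.of_forall fun w hw => ?_)
        rw [Set.indicator_of_mem, Pi.one_apply]
        calc N (w - y) = N ((w - x n) - (y - x n)) := by congr 1; abel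
          _ ≤ N (w - x n) + N (y - x n) := map_sub_le_add _ _ _
          _ ≤ δ + δ / σ := add_le_add (hV.dist_le n w hw) hy
          _ = _ := by field_simp; ring
      · rw [Set.indicator_of_notMem hy, mul_zero]
        exact zero_le
    refine (ENNReal.tsum_le_tsum hle).trans_eq ?_
    rw [hV.tsum_lintegral, lintegral_indicator_one
      (isClosed_le (by fun_prop) continuous_const :
            IsClosed {w | N (w - y) ≤ (1 + σ) * (δ / σ)}).measurableSet,
      volume_seminorm_sub_le, volume_closedBall_seminorm N (by positivity)]
  have hmain : β * ∑' n, ∫⁻ _ in V n, jetSq S g r (x n) ≤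
      β * (ENNReal.ofReal ((1 + σ) ^ d) * ∫⁻ y, H y) := by
    calc β * ∑' n, ∫⁻ _ in V n, jetSq S g r (x n)
        = ∑' n, volume (V n) * (β * jetSq S g r (x n)) := by
          rw [← ENNReal.tsum_mul_left]
          congr with n
          rw [setLIntegral_const]
          ring
      _ ≤ ∑' n, volume (V n) * ∫⁻ y in B n, H y := by
          gcongr with n
          exact hone n
      _ = ∫⁻ y, ∑' n, volume (V n) * (B n).indicator 1 y * H y := by
          have hmeas : ∀ n, AEMeasurable
              (fun y => volume (V n) * (B n).indicator (1 : Rd d → ENNReal) y * H y) volume :=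
            fun n => (((measurable_one.indicator (hBm n)).const_mul _).mul hHm).aemeasurable
          rw [lintegral_tsum hmeas]
          congr with n
          simp_rw [mul_assoc]
          have hmeas' : Measurable fun y => (B n).indicator (1 : Rd d → ENNReal) y * H y :=
            (measurable_one.indicator (hBm n)).mul hHm
          rw [lintegral_const_mul _ hmeas', ← lintegral_indicator (hBm n)]
          congr 2 with y
          by_cases hy : y ∈ B n <;> simp [hy]
      _ ≤ ∫⁻ y, ENNReal.ofReal ((1 + σ) ^ d) * β * H y := by
          refine lintegral_mono fun y => ?_
          rw [ENNReal.tsum_mul_right]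
          gcongr
          exact hcount y
      _ = _ := by
          rw [lintegral_const_mul _ hHm]
          ring
  rw [ENNReal.mul_le_mul_iff_right hβ0 hβt] at hmain
  refine hmain.trans ?_
  rw [mul_assoc]
  gcongr
  exact lintegral_jetMajorant_le hSm hS hp hg ht0 (by positivity) (by rw [ht]; field_simp) r

end sampling

section energy

variable {d : ℕ} {S : Set (Rd d)} {g : Rd d → ℂ} {m : ℝ}

/-- The quantity `∑_{|α| ≤ k} (1 / α!) h^{2α} |D^α f(u)|²`. -/
noncomputable def localEnergy (S : Set (Rd d)) (g : Rd d → ℂ) (k : ℕ) (u h : Rd d) : ENNReal :=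
  ∑ r ∈ Finset.range (k + 1), ∑ α ∈ multiIndices d r,
    ENNReal.ofReal (1 / ∏ i, ((α i).factorial : ℝ)) * (∏ i, ‖h i‖ₑ ^ α i) ^ 2 *
      ‖bandSynth S (monoSym freq α g) u‖ₑ ^ 2

theorem one_div_prod_factorial {α : Fin d → ℕ} {r : ℕ} (hα : α ∈ multiIndices d r) :
    1 / ∏ i, ((α i).factorial : ℝ) =
      (1 / (r.factorial : ℝ)) * (Nat.multinomial Finset.univ α : ℝ) := by
  have h := Nat.multinomial_spec Finset.univ α
  rw [(Finset.mem_piAntidiag.mp hα).1] at h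
  have h' : (∏ i, ((α i).factorial : ℝ)) * (Nat.multinomial Finset.univ α : ℝ) = r.factorial := by
    exact_mod_cast h
  have h0 : (∏ i, ((α i).factorial : ℝ)) ≠ 0 := by positivity
  rw [← h'] at *
  have h1 : (Nat.multinomial Finset.univ α : ℝ) ≠ 0 := by
    exact_mod_cast (Nat.multinomial_pos _ _).ne'
  field_simp

theorem ofReal_one_div_prod_factorial {α : Fin d → ℕ} {r : ℕ} (hα : α ∈ multiIndices d r) :
    ENNReal.ofReal (1 / ∏ i, ((α i).factorial : ℝ)) =
      ENNReal.ofReal (1 / (r.factorial : ℝ)) * (Nat.multinomial Finset.univ α : ENNReal) := by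
  rw [one_div_prod_factorial hα, ENNReal.ofReal_mul (by positivity), ENNReal.ofReal_natCast]

theorem sum_one_div_prod_factorial (d k : ℕ) :
    ∑ r ∈ Finset.range (k + 1), ∑ α ∈ multiIndices d r,
      ENNReal.ofReal (1 / ∏ i, ((α i).factorial : ℝ)) ≤ ENNReal.ofReal (Real.exp d) := by
  have h : ∀ r, ∑ α ∈ multiIndices d r, ENNReal.ofReal (1 / ∏ i, ((α i).factorial : ℝ)) =
      ENNReal.ofReal ((d : ℝ) ^ r / r.factorial) := fun r => by
    rw [← ENNReal.ofReal_sum_of_nonneg fun α _ => by positivity]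
    congr 1
    have h1 := Finset.sum_pow_eq_sum_piAntidiag (Finset.univ : Finset (Fin d))
      (fun _ => (1 : ℝ)) r
    simp only [one_pow, Finset.prod_const_one, mul_one, Finset.sum_const, Finset.card_univ,
      Fintype.card_fin, nsmul_eq_mul] at h1
    rw [h1, Finset.sum_div]
    refine Finset.sum_congr rfl fun α hα => ?_
    rw [one_div_prod_factorial hα]
    ring
  simp_rw [h]
  rw [← ENNReal.ofReal_sum_of_nonneg fun r _ => by positivity]
  exact ENNReal.ofReal_le_ofReal (Real.sum_le_exp_of_nonneg (by positivity) _)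

theorem measurable_localEnergy (k : ℕ) (u : Rd d) : Measurable (localEnergy S g k u) := by
  refine Finset.measurable_fun_sum _ fun r _ => Finset.measurable_fun_sum _ fun α _ => ?_
  refine (Measurable.const_mul ?_ _).mul_const _
  have : Measurable fun h : Rd d => ∏ i, ‖h i‖ₑ ^ α i :=
    Finset.measurable_fun_prod _ fun i _ => Measurable.pow_const (by fun_prop) _
  exact this.pow_const 2

theorem prod_enorm_pow_sq_le {α : Fin d → ℕ} {r : ℕ} (hα : α ∈ multiIndices d r) (h : Rd d) :
    (∏ i, ‖h i‖ₑ ^ α i) ^ 2 ≤ ‖h‖ₑ ^ (2 * r) := by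
  rw [mul_comm, pow_mul, ← (Finset.mem_piAntidiag.mp hα).1, ← Finset.prod_pow_eq_pow_sum]
  gcongr with i
  rw [← ofReal_norm, ← ofReal_norm]
  exact ENNReal.ofReal_le_ofReal (abs_coord_le_norm h i)

theorem localEnergy_le (k : ℕ) (u h : Rd d) :
    localEnergy S g k u h ≤ ∑ r ∈ Finset.range (k + 1),
      ENNReal.ofReal (1 / (r.factorial : ℝ)) * ‖h‖ₑ ^ (2 * r) * jetSq S g r u := by
  refine Finset.sum_le_sum fun r _ => ?_
  rw [jetSq, Finset.mul_sum]
  refine Finset.sum_le_sum fun α hα => ?_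
  rw [ofReal_one_div_prod_factorial hα]
  calc _ ≤ ENNReal.ofReal (1 / (r.factorial : ℝ)) * (Nat.multinomial Finset.univ α : ENNReal) *
        ‖h‖ₑ ^ (2 * r) * ‖bandSynth S (monoSym freq α g) u‖ₑ ^ 2 := by
        refine mul_le_mul_left (mul_le_mul_right ?_ _) _
        exact prod_enorm_pow_sq_le hα h
    _ = _ := by ring

theorem enorm_lineSym_div_factorial_le (hS : volume S ≠ ⊤)
    (hp : ∀ᵐ ξ ∂(volume.restrict S), ‖freq ξ‖ ≤ m) (hg : MemLp g 2 (volume.restrict S))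
    (u h : Rd d) (r : ℕ) :
    ‖bandSynth S (lineSym freq h r g) u / (r.factorial : ℂ)‖ₑ ≤ ∑ α ∈ multiIndices d r,
      ENNReal.ofReal (1 / ∏ i, ((α i).factorial : ℝ)) * (∏ i, ‖h i‖ₑ ^ α i) *
        ‖bandSynth S (monoSym freq α g) u‖ₑ := by
  rw [bandSynth, synth_lineSym_eq_sum aestronglyMeasurable_freq hp
    (integrable_of_memLp_two hS hg), Finset.sum_div]
  refine (enorm_sum_le _ _).trans (Finset.sum_le_sum fun α hα => le_of_eq ?_)
  rw [one_div_prod_factorial hα, mul_div_right_comm, mul_div_right_comm, enorm_mul, enorm_mul,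
    enorm_finsetProd]
  congr 2
  · rw [← ofReal_norm, norm_div, Complex.norm_natCast, Complex.norm_natCast]
    congr 1
    ring
  · refine Finset.prod_congr rfl fun i _ => ?_
    rw [enorm_pow]
    simp [← ofReal_norm]

theorem enorm_taylorSum_sq_le (hS : volume S ≠ ⊤)
    (hp : ∀ᵐ ξ ∂(volume.restrict S), ‖freq ξ‖ ≤ m) (hg : MemLp g 2 (volume.restrict S))
    (k : ℕ) (u h : Rd d) :
    ‖taylorSum (volume.restrict S) freq g k u h‖ₑ ^ 2 ≤
      ENNReal.ofReal (Real.exp d) * localEnergy S g k u h := by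
  have h1 : ‖taylorSum (volume.restrict S) freq g k u h‖ₑ ≤
      ∑ r ∈ Finset.range (k + 1), ∑ α ∈ multiIndices d r,
        ENNReal.ofReal (1 / ∏ i, ((α i).factorial : ℝ)) * (∏ i, ‖h i‖ₑ ^ α i) *
        ‖bandSynth S (monoSym freq α g) u‖ₑ :=
    (enorm_sum_le _ _).trans (Finset.sum_le_sum fun r _ =>
      enorm_lineSym_div_factorial_le hS hp hg u h r)
  have h2 := sum_one_div_prod_factorial d k
  rw [Finset.sum_sigma'] at h1 h2
  rw [localEnergy, Finset.sum_sigma']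
  calc _ ≤ (∑ a ∈ (Finset.range (k + 1)).sigma fun r => multiIndices d r,
        ENNReal.ofReal (1 / ∏ i, ((a.2 i).factorial : ℝ)) * 1 * ((∏ i, ‖h i‖ₑ ^ a.2 i) *
        ‖bandSynth S (monoSym freq a.2 g) u‖ₑ)) ^ 2 := by
        simp_rw [mul_one, ← mul_assoc]
        gcongr
    _ ≤ _ := ENNReal.sq_sum_mul_mul_le _ _ _ _
    _ ≤ _ := by
        simp_rw [one_pow, mul_one, mul_pow, ← mul_assoc]
        gcongr

theorem enorm_lineSym_div_factorial_sq_le (hS : volume S ≠ ⊤)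
    (hp : ∀ᵐ ξ ∂(volume.restrict S), ‖freq ξ‖ ≤ m) (hg : MemLp g 2 (volume.restrict S))
    {k r : ℕ} (hr : r ∈ Finset.range (k + 1)) (u h : Rd d) :
    ‖bandSynth S (lineSym freq h r g) u / (r.factorial : ℂ)‖ₑ ^ 2 ≤
      ENNReal.ofReal (Real.exp d) * localEnergy S g k u h := by
  have h2 := sum_one_div_prod_factorial d k
  have h2' : ∑ α ∈ multiIndices d r, ENNReal.ofReal (1 / ∏ i, ((α i).factorial : ℝ)) ≤
      ENNReal.ofReal (Real.exp d) := le_trans (Finset.single_le_sum (f := fun r =>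
        ∑ α ∈ multiIndices d r, ENNReal.ofReal (1 / ∏ i, ((α i).factorial : ℝ)))
        (fun _ _ => zero_le) hr) h2
  have h3 : ∑ α ∈ multiIndices d r, ENNReal.ofReal (1 / ∏ i, ((α i).factorial : ℝ)) *
      (∏ i, ‖h i‖ₑ ^ α i) ^ 2 * ‖bandSynth S (monoSym freq α g) u‖ₑ ^ 2 ≤
      localEnergy S g k u h := Finset.single_le_sum (f := fun r =>
        ∑ α ∈ multiIndices d r, ENNReal.ofReal (1 / ∏ i, ((α i).factorial : ℝ)) *
      (∏ i, ‖h i‖ₑ ^ α i) ^ 2 * ‖bandSynth S (monoSym freq α g) u‖ₑ ^ 2)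
        (fun _ _ => zero_le) hr
  calc _ ≤ (∑ α ∈ multiIndices d r,
        ENNReal.ofReal (1 / ∏ i, ((α i).factorial : ℝ)) * 1 * ((∏ i, ‖h i‖ₑ ^ α i) *
        ‖bandSynth S (monoSym freq α g) u‖ₑ)) ^ 2 := by
        simp_rw [mul_one, ← mul_assoc]
        gcongr
        exact enorm_lineSym_div_factorial_le hS hp hg u h r
    _ ≤ _ := ENNReal.sq_sum_mul_mul_le _ _ _ _
    _ ≤ _ := by
        simp_rw [one_pow, mul_one, mul_pow, ← mul_assoc]
        gcongr

variable {N : Seminorm ℝ (Rd d)} {I : Type*} {x : I → Rd d} {V : I → Set (Rd d)} {δ b : ℝ}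

/-- The quantity `∑_n ∑_{|α| ≤ k} μ_{n,α} |D^α f(x_n)|²`. -/
noncomputable def frameEnergy (S : Set (Rd d)) (g : Rd d → ℂ) (k : ℕ) (x : I → Rd d)
    (V : I → Set (Rd d)) : ENNReal :=
  ∑' n, ∫⁻ y in V n, localEnergy S g k (x n) (y - x n)

theorem frameEnergy_le (hSm : MeasurableSet S) (hS : volume S ≠ ⊤)
    (hp : ∀ᵐ ξ ∂(volume.restrict S), ‖freq ξ‖ ≤ m) (hg : MemLp g 2 (volume.restrict S))
    (hV : IsCellCover N x V δ) (hb0 : 0 < b) (hb : ∀ v, ‖v‖ ≤ b * N v) (hδ : 0 < δ) (hm : 0 < m)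
    (k : ℕ) :
    frameEnergy S g k x V ≤ ENNReal.ofReal (Real.exp (2 * (b * δ * m) + (b * δ * m) ^ 2)) *
      ∫⁻ ξ in S, ‖g ξ‖ₑ ^ 2 := by
  have hz : 0 < b * δ * m := by positivity
  set z := b * δ * m with hzdef
  have h1 : frameEnergy S g k x V ≤ ∑ r ∈ Finset.range (k + 1),
      ENNReal.ofReal (1 / (r.factorial : ℝ)) * ENNReal.ofReal (b * δ) ^ (2 * r) *
        ∑' n, ∫⁻ _ in V n, jetSq S g r (x n) := by
    simp_rw [← ENNReal.tsum_mul_left]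
    rw [← Summable.tsum_finsetSum fun _ _ => ENNReal.summable]
    refine ENNReal.tsum_le_tsum fun n => ?_
    calc ∫⁻ y in V n, localEnergy S g k (x n) (y - x n)
        ≤ ∫⁻ _ in V n, ∑ r ∈ Finset.range (k + 1), ENNReal.ofReal (1 / (r.factorial : ℝ)) *
          ENNReal.ofReal (b * δ) ^ (2 * r) * jetSq S g r (x n) := by
          refine setLIntegral_mono_ae aemeasurable_const (Filter.Eventually.of_forall
            fun y hy => (localEnergy_le k (x n) (y - x n)).trans ?_)
          gcongr with r _
          rw [← ofReal_norm]
          refine ENNReal.ofReal_le_ofReal ((hb _).trans ?_)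
          gcongr
          exact hV.dist_le n y hy
      _ = _ := by
          simp only [setLIntegral_const]
          rw [Finset.sum_mul]
          refine Finset.sum_congr rfl fun r _ => ?_
          ring
  refine h1.trans ?_
  calc _ ≤ ∑ r ∈ Finset.range (k + 1), ENNReal.ofReal ((z ^ 2) ^ r / (r.factorial : ℝ)) *
        (ENNReal.ofReal (Real.exp z) ^ 2 * ∫⁻ ξ in S, ‖g ξ‖ₑ ^ 2) := by
        refine Finset.sum_le_sum fun r _ => ?_
        refine (mul_le_mul_right (tsum_jetSq_le hSm hS hp hg hV hb0 hb hδ hm r) _).trans_eq ?_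
        have : ENNReal.ofReal ((z ^ 2) ^ r / (r.factorial : ℝ)) =
            ENNReal.ofReal (1 / (r.factorial : ℝ)) * ENNReal.ofReal (b * δ) ^ (2 * r) *
              ENNReal.ofReal m ^ (2 * r) := by
          rw [mul_assoc, ← mul_pow, ← ENNReal.ofReal_mul (by positivity),
            ← ENNReal.ofReal_pow (by positivity), ← ENNReal.ofReal_mul (by positivity), ← pow_mul]
          congr 1
          ring
        rw [this]
        ring
    _ ≤ ENNReal.ofReal (Real.exp (z ^ 2)) *
        (ENNReal.ofReal (Real.exp z) ^ 2 * ∫⁻ ξ in S, ‖g ξ‖ₑ ^ 2) := by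
        rw [← Finset.sum_mul, ← ENNReal.ofReal_sum_of_nonneg fun r _ => by positivity]
        gcongr
        exact Real.sum_le_exp_of_nonneg (by positivity) _
    _ = _ := by
        rw [← mul_assoc, ← ENNReal.ofReal_pow (by positivity), ← ENNReal.ofReal_mul (by positivity),
          ← Real.exp_nat_mul, ← Real.exp_add]
        congr 3
        push_cast
        ring

theorem tsum_enorm_sub_taylorSum_sq_le (hS : volume S ≠ ⊤)
    (hp : ∀ᵐ ξ ∂(volume.restrict S), ‖freq ξ‖ ≤ m) (hg : MemLp g 2 (volume.restrict S))
    (hV : IsCellCover N x V δ) (hb0 : 0 < b) (hb : ∀ v, ‖v‖ ≤ b * N v) (hδ : 0 < δ) (hm : 0 < m)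
    (k : ℕ) {C : ENNReal} {E : ENNReal}
    (hC : ∀ r, ∑' n, ∫⁻ _ in V n, jetSq S g r (x n) ≤ C * (ENNReal.ofReal m ^ (2 * r) * E)) :
    ∑' n, ∫⁻ y in V n,
      ‖bandSynth S g y - taylorSum (volume.restrict S) freq g k (x n) (y - x n)‖ₑ ^ 2 ≤
      ENNReal.ofReal (expRemainder k (b * δ * m)) ^ 2 * C * E := by
  have hz : 0 < b * δ * m := by positivity
  set z := b * δ * m with hzdef
  set R := expRemainder k z
  have hR := hasSum_expRemainder k z
  have h1 : ∀ n, ∫⁻ y in V n,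
      ‖bandSynth S g y - taylorSum (volume.restrict S) freq g k (x n) (y - x n)‖ₑ ^ 2 ≤
      ENNReal.ofReal R * ∑' s : ℕ,
        ENNReal.ofReal (z ^ (s + (k + 1)) / ((s + (k + 1)).factorial : ℝ)) *
        (ENNReal.ofReal ((z ^ (s + (k + 1)))⁻¹) ^ 2 * (ENNReal.ofReal (b * δ) ^ (2 * (s + (k + 1))) *
          ∫⁻ _ in V n, jetSq S g (s + (k + 1)) (x n))) := fun n => by
    have h2 : ∀ y ∈ V n,
        ‖bandSynth S g y - taylorSum (volume.restrict S) freq g k (x n) (y - x n)‖ₑ ^ 2 ≤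
        ENNReal.ofReal R * ∑' s : ℕ,
        ENNReal.ofReal (z ^ (s + (k + 1)) / ((s + (k + 1)).factorial : ℝ)) *
        (ENNReal.ofReal ((z ^ (s + (k + 1)))⁻¹) ^ 2 * (ENNReal.ofReal (b * δ) ^ (2 * (s + (k + 1))) *
          jetSq S g (s + (k + 1)) (x n))) := fun y hy => by
      have h3 := hasSum_sub_taylorSum aestronglyMeasurable_freq hp
        (integrable_of_memLp_two hS hg) k (x n) (y - x n)
      rw [add_sub_cancel] at h3
      refine (enorm_sq_le_of_hasSum_div_factorial (e := fun s => s + (k + 1)) hz hR h3).trans ?_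
      gcongr with s
      refine (enorm_lineSym_sq_le hS hp hg _ _ _).trans ?_
      gcongr
      rw [← ofReal_norm]
      refine ENNReal.ofReal_le_ofReal ((hb _).trans ?_)
      gcongr
      exact hV.dist_le n y hy
    refine (setLIntegral_mono_ae aemeasurable_const (Filter.Eventually.of_forall h2)).trans_eq ?_
    simp only [setLIntegral_const]
    rw [mul_assoc, ← ENNReal.tsum_mul_right]
    simp only [mul_assoc]
  refine (ENNReal.tsum_le_tsum h1).trans ?_
  rw [ENNReal.tsum_mul_left, ENNReal.tsum_comm]
  simp_rw [ENNReal.tsum_mul_left]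
  rw [sq, mul_assoc, mul_assoc]
  refine mul_le_mul_right ?_ _
  rw [← tsum_ofReal_weights hz hR]
  refine ENNReal.tsum_le_tsum fun s => mul_le_mul_right (mul_le_mul_right ?_ _) _
  refine (mul_le_mul_right (hC _) _).trans_eq ?_
  rw [hzdef, ENNReal.ofReal_mul (p := b * δ) (by positivity), mul_pow]
  ring

theorem enorm_sq_le_add {a c : ℂ} {q : ℝ} (hq0 : 0 < q) (hq1 : q < 1) :
    ‖a‖ₑ ^ 2 ≤ ENNReal.ofReal (1 / (1 - q)) * ‖c‖ₑ ^ 2 + ENNReal.ofReal (1 / q) * ‖a - c‖ₑ ^ 2 := by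
  have h1 : 0 < 1 - q := by linarith
  simp only [← ofReal_norm, ← ENNReal.ofReal_pow (norm_nonneg _)]
  rw [← ENNReal.ofReal_mul (by positivity), ← ENNReal.ofReal_mul (by positivity),
    ← ENNReal.ofReal_add (by positivity) (by positivity)]
  refine ENNReal.ofReal_le_ofReal ?_
  have h2 : ‖a‖ ≤ ‖c‖ + ‖a - c‖ := by
    calc ‖a‖ = ‖c + (a - c)‖ := by congr 1; ring
      _ ≤ _ := norm_add_le _ _
  calc ‖a‖ ^ 2 ≤ (‖c‖ + ‖a - c‖) ^ 2 := by gcongr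
    _ ≤ _ := by
      rw [← sub_nonneg]
      have : 1 / (1 - q) * ‖c‖ ^ 2 + 1 / q * ‖a - c‖ ^ 2 - (‖c‖ + ‖a - c‖) ^ 2 =
          (q * ‖c‖ - (1 - q) * ‖a - c‖) ^ 2 / (q * (1 - q)) := by
        field_simp
        ring
      rw [this]
      positivity

theorem lintegral_enorm_sq_ne_top (hg : MemLp g 2 (volume.restrict S)) :
    ∫⁻ ξ in S, ‖g ξ‖ₑ ^ 2 ≠ ⊤ := by
  have h2 := eLpNorm_nnreal_pow_eq_lintegral (p := 2) (f := g) (μ := volume.restrict S) two_ne_zero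
  simp only [NNReal.coe_ofNat, ENNReal.coe_ofNat, ENNReal.rpow_two] at h2
  rw [← h2]
  exact ENNReal.pow_ne_top hg.eLpNorm_ne_top

theorem le_frameEnergy (hSm : MeasurableSet S) (hS : volume S ≠ ⊤)
    (hp : ∀ᵐ ξ ∂(volume.restrict S), ‖freq ξ‖ ≤ m) (hg : MemLp g 2 (volume.restrict S))
    (hV : IsCellCover N x V δ) (hb0 : 0 < b) (hb : ∀ v, ‖v‖ ≤ b * N v) (hδ : 0 < δ) (hm : 0 < m)
    (k : ℕ) {C : ENNReal} {q : ℝ} (hq0 : 0 < q) (hq1 : q < 1)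
    (hC : ∀ r, ∑' n, ∫⁻ _ in V n, jetSq S g r (x n) ≤
      C * (ENNReal.ofReal m ^ (2 * r) * ∫⁻ ξ in S, ‖g ξ‖ₑ ^ 2))
    (hCq : ENNReal.ofReal (expRemainder k (b * δ * m)) ^ 2 * C ≤ ENNReal.ofReal (q ^ 2)) :
    ENNReal.ofReal (Real.exp (-d) * (1 - q) ^ 2) * ∫⁻ ξ in S, ‖g ξ‖ₑ ^ 2 ≤
      frameEnergy S g k x V := by
  set E := ∫⁻ ξ in S, ‖g ξ‖ₑ ^ 2 with hE
  have hq1' : 0 < 1 - q := by linarith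
  have hEtop : E ≠ ⊤ := lintegral_enorm_sq_ne_top hg
  have h1 : E ≤ ENNReal.ofReal (1 / (1 - q)) * (ENNReal.ofReal (Real.exp d) *
      frameEnergy S g k x V) + ENNReal.ofReal q * E := by
    calc E = ∑' n, ∫⁻ y in V n, ‖bandSynth S g y‖ₑ ^ 2 := by
          rw [hV.tsum_lintegral, hE, lintegral_synth_sq hSm hS hg]
      _ ≤ ∑' n, ((ENNReal.ofReal (1 / (1 - q)) * (ENNReal.ofReal (Real.exp d) *
          ∫⁻ y in V n, localEnergy S g k (x n) (y - x n))) + ENNReal.ofReal (1 / q) *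
          ∫⁻ y in V n,
      ‖bandSynth S g y - taylorSum (volume.restrict S) freq g k (x n) (y - x n)‖ₑ ^ 2) := by
          refine ENNReal.tsum_le_tsum fun n => ?_
          have hmeas : Measurable fun y => localEnergy S g k (x n) (y - x n) :=
            (measurable_localEnergy k (x n)).comp (measurable_sub_const _)
          rw [← lintegral_const_mul _ hmeas, ← lintegral_const_mul _ (hmeas.const_mul _),
            ← lintegral_const_mul' _ _ ENNReal.ofReal_ne_top,
            ← lintegral_add_left ((hmeas.const_mul _).const_mul _)]
          refine lintegral_mono fun y => (enorm_sq_le_add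
            (c := taylorSum (volume.restrict S) freq g k (x n) (y - x n)) hq0 hq1).trans ?_
          gcongr
          exact enorm_taylorSum_sq_le hS hp hg k _ _
      _ ≤ _ := by
          rw [ENNReal.tsum_add, ENNReal.tsum_mul_left, ENNReal.tsum_mul_left, ENNReal.tsum_mul_left,
            frameEnergy]
          refine add_le_add_right ?_ _
          calc _ ≤ ENNReal.ofReal (1 / q) * (ENNReal.ofReal (q ^ 2) * E) := by
                refine mul_le_mul_right ?_ _
                refine (tsum_enorm_sub_taylorSum_sq_le hS hp hg hV hb0 hb hδ hm k hC).trans ?_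
                gcongr
            _ = _ := by
                rw [← mul_assoc, ← ENNReal.ofReal_mul (by positivity)]
                congr 2
                field_simp
  have h2 : ENNReal.ofReal (1 - q) * E ≤ ENNReal.ofReal (1 / (1 - q)) *
      (ENNReal.ofReal (Real.exp d) * frameEnergy S g k x V) := by
    have h3 : E = ENNReal.ofReal (1 - q) * E + ENNReal.ofReal q * E := by
      rw [← add_mul, ← ENNReal.ofReal_add hq1'.le hq0.le]
      simp
    conv_lhs at h1 => rw [h3]
    exact (ENNReal.add_le_add_iff_right (ENNReal.mul_ne_top ENNReal.ofReal_ne_top hEtop)).mp h1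
  calc _ = ENNReal.ofReal (Real.exp (-d)) * ENNReal.ofReal (1 - q) *
        (ENNReal.ofReal (1 - q) * E) := by
        rw [← mul_assoc, ← ENNReal.ofReal_mul (by positivity), ← ENNReal.ofReal_mul (by positivity)]
        congr 2
        ring
    _ ≤ ENNReal.ofReal (Real.exp (-d)) * ENNReal.ofReal (1 - q) * _ := mul_le_mul_right h2 _
    _ = _ := by
        rw [← mul_assoc, ← mul_assoc, ← ENNReal.ofReal_mul (by positivity),
          ← ENNReal.ofReal_mul (by positivity), ← ENNReal.ofReal_mul (by positivity)]
        rw [show Real.exp (-d) * (1 - q) * (1 / (1 - q)) * Real.exp d = 1 by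
          rw [mul_assoc (Real.exp _), mul_one_div_cancel hq1'.ne', mul_one, ← Real.exp_add]
          simp]
        simp

end energy

section sup

variable {d : ℕ} {Z : Type*} [MeasurableSpace Z] {lam : Measure Z} {p : Z → Rd d} {g : Z → ℂ}
  {τ δ b R η ρ₀ : ℝ} {N : Seminorm ℝ (Rd d)} {I : Type*} {x : I → Rd d} {V : I → Set (Rd d)}

theorem sup_sq_le_tsum_taylorSum (hpm : AEStronglyMeasurable p lam)
    (hp : ∀ᵐ ζ ∂lam, ‖p ζ‖ ≤ τ) (hτ : 0 ≤ τ) (hg : Integrable g lam)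
    (hV : IsCellCover N x V δ) (hb0 : 0 < b) (hb : ∀ v, ‖v‖ ≤ b * N v) (k : ℕ)
    (hR : expRemainder k (τ * (b * δ)) ≤ R) (hη : 0 < η) (hRη : R + 3 * η ≤ 1)
    (hρ : expRemainder 0 (τ * ρ₀) ≤ η) (u : Rd d) :
    ENNReal.ofReal η ^ 2 * volume (Metric.closedBall (0 : Rd d) ρ₀) * ‖synth lam p g u‖ₑ ^ 2 ≤
      ∑' n, ∫⁻ y in V n, ‖taylorSum lam p g k (x n) (y - x n)‖ₑ ^ 2 := by
  set F := synth lam p g with hF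
  have hbdd : BddAbove (Set.range fun u => ‖F u‖) :=
    ⟨∫ ζ, ‖g ζ‖ ∂lam, by rintro _ ⟨u, rfl⟩; exact norm_synth_le u⟩
  set M := ⨆ u, ‖F u‖ with hM
  have hFM : ∀ u, ‖F u‖ ≤ M := fun u => le_ciSup hbdd u
  have hM0 : 0 ≤ M := (norm_nonneg _).trans (hFM 0)
  rcases hM0.eq_or_lt with h0 | hMpos
  · have : F u = 0 := norm_le_zero_iff.mp ((hFM u).trans h0.symm.le)
    simp [this]
  obtain ⟨w, hw⟩ : ∃ w, (1 - η) * M < ‖F w‖ :=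
    exists_lt_of_lt_ciSup (f := fun u => ‖F u‖) (show (1 - η) * M < ⨆ u, ‖F u‖ by
      rw [← hM]; nlinarith)
  have hlow : ∀ n, ∀ y ∈ V n, y ∈ Metric.closedBall w ρ₀ →
      η * M ≤ ‖taylorSum lam p g k (x n) (y - x n)‖ := fun n y hy hyw => by
    have h1 := norm_sub_taylorSum_le hpm hp hτ hg hFM k (x n) (y - x n)
    rw [add_sub_cancel] at h1
    have h2 := norm_sub_taylorSum_le hpm hp hτ hg hFM 0 w (y - w)
    rw [add_sub_cancel] at h2
    have h3 : taylorSum lam p g 0 w (y - w) = F w := by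
      simp [taylorSum, lineSym_zero, hF]
    rw [h3] at h2
    have h4 : expRemainder k (τ * ‖y - x n‖) ≤ R := by
      refine (expRemainder_mono k (by positivity) ?_).trans hR
      gcongr
      exact (hb _).trans (by gcongr; exact hV.dist_le n y hy)
    have h5 : expRemainder 0 (τ * ‖y - w‖) ≤ η := by
      refine (expRemainder_mono 0 (by positivity) ?_).trans hρ
      gcongr
      rw [← dist_eq_norm]
      exact hyw
    have h6 : ‖F w‖ ≤ ‖taylorSum lam p g k (x n) (y - x n)‖ +
        ‖F y - taylorSum lam p g k (x n) (y - x n)‖ + ‖F y - F w‖ := by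
      calc ‖F w‖ = ‖taylorSum lam p g k (x n) (y - x n) +
            (F y - taylorSum lam p g k (x n) (y - x n)) - (F y - F w)‖ := by congr 1; ring
        _ ≤ _ := (norm_sub_le _ _).trans (by gcongr; exact norm_add_le _ _)
    have h7 : ‖F y - taylorSum lam p g k (x n) (y - x n)‖ ≤ R * M := h1.trans (by gcongr)
    have h8 : ‖F y - F w‖ ≤ η * M := h2.trans (by gcongr)
    nlinarith
  calc ENNReal.ofReal η ^ 2 * volume (Metric.closedBall (0 : Rd d) ρ₀) * ‖F u‖ₑ ^ 2
      ≤ ENNReal.ofReal η ^ 2 * volume (Metric.closedBall (0 : Rd d) ρ₀) *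
        ENNReal.ofReal M ^ 2 := by
        gcongr
        rw [← ofReal_norm]
        exact ENNReal.ofReal_le_ofReal (hFM u)
    _ = ∫⁻ y, (Metric.closedBall w ρ₀).indicator (fun _ => ENNReal.ofReal (η * M) ^ 2) y := by
        rw [lintegral_indicator Metric.isClosed_closedBall.measurableSet, setLIntegral_const,
          ENNReal.ofReal_mul hη.le, Measure.addHaar_closedBall_center volume w ρ₀]
        ring
    _ = ∑' n, ∫⁻ y in V n,
        (Metric.closedBall w ρ₀).indicator (fun _ => ENNReal.ofReal (η * M) ^ 2) y :=
        (hV.tsum_lintegral _).symm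
    _ ≤ _ := by
        refine ENNReal.tsum_le_tsum fun n => setLIntegral_mono' (hV.measurableSet n) fun y hy => ?_
        by_cases hyw : y ∈ Metric.closedBall w ρ₀
        · rw [Set.indicator_of_mem hyw, ← ofReal_norm]
          gcongr
          exact hlow n y hy hyw
        · rw [Set.indicator_of_notMem hyw]
          exact zero_le

end sup

section product

variable {d : ℕ} {S T : Set (Rd d)} {g θ : Rd d → ℂ} {m ε : ℝ}

/-- The spectrum of the product of `bandSynth S g` and a translate of `bandSynth T θ`. -/
noncomputable def prodSpec (g θ : Rd d → ℂ) (y : Rd d) (ζ : Rd d × Rd d) : ℂ :=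
  g ζ.1 * (Complex.exp (-(Complex.I * (inner ℝ (freq ζ.2) y : ℝ))) * θ ζ.2)

theorem integrable_exp_neg_mul (hθ : Integrable θ (volume.restrict T)) (y : Rd d) :
    Integrable (fun ξ => Complex.exp (-(Complex.I * (inner ℝ (freq ξ) y : ℝ))) * θ ξ)
      (volume.restrict T) := by
  have := integrable_exp_inner_mul aestronglyMeasurable_freq hθ (-y)
  simpa only [inner_neg_right, Complex.ofReal_neg, mul_neg] using this

theorem integrable_prodSpec (hg : Integrable g (volume.restrict S))
    (hθ : Integrable θ (volume.restrict T)) (y : Rd d) :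
    Integrable (prodSpec g θ y) ((volume.restrict S).prod (volume.restrict T)) :=
  hg.mul_prod (integrable_exp_neg_mul hθ y)

theorem aestronglyMeasurable_freq_add :
    AEStronglyMeasurable (fun ζ : Rd d × Rd d => freq ζ.1 + freq ζ.2)
      ((volume.restrict S).prod (volume.restrict T)) :=
  ((continuous_freq.comp continuous_fst).add
    (continuous_freq.comp continuous_snd)).aestronglyMeasurable

theorem norm_freq_add_le (hp : ∀ᵐ ξ ∂(volume.restrict S), ‖freq ξ‖ ≤ m)
    (hq : ∀ᵐ ξ ∂(volume.restrict T), ‖freq ξ‖ ≤ ε) :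
    ∀ᵐ ζ ∂((volume.restrict S).prod (volume.restrict T)),
      ‖freq ζ.1 + freq ζ.2‖ ≤ m + ε := by
  filter_upwards [Measure.quasiMeasurePreserving_fst.ae hp,
    Measure.quasiMeasurePreserving_snd.ae hq] with ζ h1 h2
  exact (norm_add_le _ _).trans (add_le_add h1 h2)

theorem synth_lineSym_prodSpec (hp : ∀ᵐ ξ ∂(volume.restrict S), ‖freq ξ‖ ≤ m)
    (hq : ∀ᵐ ξ ∂(volume.restrict T), ‖freq ξ‖ ≤ ε) (hg : Integrable g (volume.restrict S))
    (hθ : Integrable θ (volume.restrict T)) (y h u : Rd d) (r : ℕ) :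
    synth ((volume.restrict S).prod (volume.restrict T)) (fun ζ => freq ζ.1 + freq ζ.2)
      (lineSym (fun ζ => freq ζ.1 + freq ζ.2) h r (prodSpec g θ y)) u =
    ∑ j ∈ Finset.range (r + 1), bandSynth S (lineSym freq h j g) u *
      bandSynth T (lineSym freq h (r - j) θ) (u - y) * (r.choose j : ℂ) := by
  have hA : ∀ j, Integrable (fun ξ => Complex.exp (Complex.I * (inner ℝ (freq ξ) u : ℝ)) *
      lineSym freq h j g ξ) (volume.restrict S) := fun j =>
    integrable_exp_inner_mul aestronglyMeasurable_freq
      (integrable_lineSym aestronglyMeasurable_freq hp hg h j) u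
  have hB : ∀ j, Integrable (fun ξ => Complex.exp (Complex.I * (inner ℝ (freq ξ) (u - y) : ℝ)) *
      lineSym freq h j θ ξ) (volume.restrict T) := fun j =>
    integrable_exp_inner_mul aestronglyMeasurable_freq
      (integrable_lineSym aestronglyMeasurable_freq hq hθ h j) (u - y)
  simp only [bandSynth, synth]
  simp_rw [← integral_prod_mul, ← integral_mul_const]
  rw [← integral_finsetSum _ fun j _ => ((hA j).mul_prod (hB (r - j))).mul_const _]
  congr with ζ
  rw [lineSym, inner_add_left, inner_add_left]
  push_cast
  rw [mul_add, mul_add, add_pow, Complex.exp_add, Finset.sum_mul, Finset.mul_sum]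
  refine Finset.sum_congr rfl fun j _ => ?_
  rw [prodSpec, lineSym, lineSym, inner_sub_right]
  push_cast
  rw [mul_sub, sub_eq_add_neg (Complex.I * ((inner ℝ (freq ζ.2) u : ℝ) : ℂ)), Complex.exp_add]
  ring

theorem synth_prodSpec (hp : ∀ᵐ ξ ∂(volume.restrict S), ‖freq ξ‖ ≤ m)
    (hq : ∀ᵐ ξ ∂(volume.restrict T), ‖freq ξ‖ ≤ ε) (hg : Integrable g (volume.restrict S))
    (hθ : Integrable θ (volume.restrict T)) (y u : Rd d) :
    synth ((volume.restrict S).prod (volume.restrict T)) (fun ζ => freq ζ.1 + freq ζ.2)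
      (prodSpec g θ y) u = bandSynth S g u * bandSynth T θ (u - y) := by
  have h := synth_lineSym_prodSpec hp hq hg hθ y 0 u 0
  simpa [lineSym_zero] using h

theorem enorm_taylorSum_prodSpec_le (hp : ∀ᵐ ξ ∂(volume.restrict S), ‖freq ξ‖ ≤ m)
    (hq : ∀ᵐ ξ ∂(volume.restrict T), ‖freq ξ‖ ≤ ε) (hg : Integrable g (volume.restrict S))
    (hθ : Integrable θ (volume.restrict T)) (y h u : Rd d) (k : ℕ) :
    ‖taylorSum ((volume.restrict S).prod (volume.restrict T)) (fun ζ => freq ζ.1 + freq ζ.2)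
      (prodSpec g θ y) k u h‖ₑ ≤
    (∑ j ∈ Finset.range (k + 1), ‖bandSynth S (lineSym freq h j g) u / (j.factorial : ℂ)‖ₑ) *
      ∑ j ∈ Finset.range (k + 1), ‖bandSynth T (lineSym freq h j θ) (u - y)‖ₑ := by
  set a : ℕ → ℂ := fun j => bandSynth S (lineSym freq h j g) u / (j.factorial : ℂ) with ha
  set c : ℕ → ℂ := fun j => bandSynth T (lineSym freq h j θ) (u - y) with hc
  have h1 : taylorSum ((volume.restrict S).prod (volume.restrict T))
      (fun ζ => freq ζ.1 + freq ζ.2) (prodSpec g θ y) k u h =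
      ∑ r ∈ Finset.range (k + 1), ∑ j ∈ Finset.range (r + 1),
        a j * (c (r - j) / ((r - j).factorial : ℂ)) := by
    refine Finset.sum_congr rfl fun r _ => ?_
    rw [synth_lineSym_prodSpec hp hq hg hθ, Finset.sum_div]
    refine Finset.sum_congr rfl fun j hj => ?_
    have hjr : j ≤ r := Nat.lt_succ_iff.mp (Finset.mem_range.mp hj)
    rw [Nat.cast_choose ℂ hjr]
    have h2 : (r.factorial : ℂ) ≠ 0 := by exact_mod_cast r.factorial_ne_zero
    have h3 : (j.factorial : ℂ) ≠ 0 := by exact_mod_cast j.factorial_ne_zero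
    have h4 : ((r - j).factorial : ℂ) ≠ 0 := by exact_mod_cast (r - j).factorial_ne_zero
    simp only [ha, hc]
    field_simp
  have hcle : ∀ j, ‖c j / (j.factorial : ℂ)‖ₑ ≤ ‖c j‖ₑ := fun j => by
    rw [← ofReal_norm, ← ofReal_norm, norm_div, Complex.norm_natCast]
    refine ENNReal.ofReal_le_ofReal (div_le_self (norm_nonneg _) ?_)
    exact_mod_cast j.factorial_pos
  rw [h1, Finset.sum_range_diag_flip (k + 1) fun i j => a i * (c j / (j.factorial : ℂ)),
    Finset.sum_mul]
  refine (enorm_sum_le _ _).trans (Finset.sum_le_sum fun i _ => ?_)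
  rw [← Finset.mul_sum, enorm_mul]
  gcongr
  refine (enorm_sum_le _ _).trans ((Finset.sum_le_sum fun j _ => hcle j).trans ?_)
  exact Finset.sum_le_sum_of_subset (Finset.range_subset_range.mpr (Nat.sub_le _ _))

theorem ENNReal.sq_sum_range_le (k : ℕ) (a : ℕ → ENNReal) :
    (∑ j ∈ Finset.range k, a j) ^ 2 ≤ k * ∑ j ∈ Finset.range k, a j ^ 2 := by
  simpa using ENNReal.sq_sum_mul_mul_le (Finset.range k) 1 1 a

/-- A majorant of the first `k` derivatives of `bandSynth T θ`. -/
noncomputable def windowMajorant (T : Set (Rd d)) (θ : Rd d → ℂ) (k : ℕ) (ρ : ℝ) (v : Rd d) :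
    ENNReal :=
  ∑ j ∈ Finset.range (k + 1), ENNReal.ofReal ρ ^ (2 * j) * jetSq T θ j v

theorem measurable_windowMajorant (hT : volume T ≠ ⊤)
    (hq : ∀ᵐ ξ ∂(volume.restrict T), ‖freq ξ‖ ≤ ε) (hθ : MemLp θ 2 (volume.restrict T))
    (k : ℕ) (ρ : ℝ) : Measurable (windowMajorant T θ k ρ) :=
  Finset.measurable_fun_sum _ fun j _ => (measurable_jetSq hT hq hθ j).const_mul _

theorem lintegral_windowMajorant_ne_top (hTm : MeasurableSet T) (hT : volume T ≠ ⊤)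
    (hq : ∀ᵐ ξ ∂(volume.restrict T), ‖freq ξ‖ ≤ ε) (hθ : MemLp θ 2 (volume.restrict T))
    (k : ℕ) (ρ : ℝ) : ∫⁻ v, windowMajorant T θ k ρ v ≠ ⊤ := by
  simp only [windowMajorant]
  rw [lintegral_finsetSum _ fun j _ => (measurable_jetSq hT hq hθ j).const_mul _]
  refine (ENNReal.sum_lt_top.mpr fun j _ => ?_).ne
  rw [lintegral_const_mul _ (measurable_jetSq hT hq hθ j)]
  refine ENNReal.mul_lt_top (by finiteness) ?_
  refine (lintegral_jetSq_le hTm hT hq hθ j).trans_lt (ENNReal.mul_lt_top (by finiteness) ?_)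
  exact (lintegral_enorm_sq_ne_top hθ).lt_top

theorem enorm_taylorSum_prodSpec_sq_le (hS : volume S ≠ ⊤) (hT : volume T ≠ ⊤)
    (hp : ∀ᵐ ξ ∂(volume.restrict S), ‖freq ξ‖ ≤ m)
    (hq : ∀ᵐ ξ ∂(volume.restrict T), ‖freq ξ‖ ≤ ε) (hg : MemLp g 2 (volume.restrict S))
    (hθ : MemLp θ 2 (volume.restrict T)) (y u : Rd d) {h : Rd d} {ρ : ℝ} (hh : ‖h‖ ≤ ρ) (k : ℕ) :
    ‖taylorSum ((volume.restrict S).prod (volume.restrict T)) (fun ζ => freq ζ.1 + freq ζ.2)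
      (prodSpec g θ y) k u h‖ₑ ^ 2 ≤
    ((k + 1 : ℕ) : ENNReal) ^ 3 * ENNReal.ofReal (Real.exp d) *
      (localEnergy S g k u h * windowMajorant T θ k ρ (u - y)) := by
  have h1 := enorm_taylorSum_prodSpec_le hp hq (integrable_of_memLp_two hS hg)
    (integrable_of_memLp_two hT hθ) y h u k
  have h2 : (∑ j ∈ Finset.range (k + 1),
      ‖bandSynth S (lineSym freq h j g) u / (j.factorial : ℂ)‖ₑ) ^ 2 ≤
      ((k + 1 : ℕ) : ENNReal) * (((k + 1 : ℕ) : ENNReal) *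
        (ENNReal.ofReal (Real.exp d) * localEnergy S g k u h)) := by
    refine (ENNReal.sq_sum_range_le _ _).trans (mul_le_mul_right ?_ _)
    refine (Finset.sum_le_sum fun j hj =>
      enorm_lineSym_div_factorial_sq_le hS hp hg hj u h).trans_eq ?_
    rw [Finset.sum_const, Finset.card_range, nsmul_eq_mul]
  have h3 : (∑ j ∈ Finset.range (k + 1), ‖bandSynth T (lineSym freq h j θ) (u - y)‖ₑ) ^ 2 ≤
      ((k + 1 : ℕ) : ENNReal) * windowMajorant T θ k ρ (u - y) := by
    refine (ENNReal.sq_sum_range_le _ _).trans (mul_le_mul_right ?_ _)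
    refine Finset.sum_le_sum fun j _ => (enorm_lineSym_sq_le hT hq hθ h j _).trans ?_
    gcongr
    rw [← ofReal_norm]
    exact ENNReal.ofReal_le_ofReal hh
  refine (pow_le_pow_left' h1 2).trans ?_
  rw [mul_pow]
  refine (mul_le_mul' h2 h3).trans_eq ?_
  ring

end product

section lower

variable {d : ℕ} {S : Set (Rd d)} {m δ b : ℝ} {N : Seminorm ℝ (Rd d)} {I : Type*} [Countable I]
  {x : I → Rd d} {V : I → Set (Rd d)}

theorem exists_window (d : ℕ) {ε : ℝ} (hε : 0 < ε) :
    ∃ (T : Set (Rd d)) (θ : Rd d → ℂ), MeasurableSet T ∧ volume T ≠ ⊤ ∧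
      (∀ᵐ ξ ∂(volume.restrict T), ‖freq ξ‖ ≤ ε) ∧ MemLp θ 2 (volume.restrict T) ∧
      bandSynth T θ 0 = 1 := by
  set T : Set (Rd d) := Metric.closedBall 0 (ε / (2 * Real.pi)) with hTdef
  have hr : 0 < ε / (2 * Real.pi) := by positivity
  have hTm : MeasurableSet T := Metric.isClosed_closedBall.measurableSet
  have hT : volume T ≠ ⊤ := measure_closedBall_lt_top.ne
  have hT0 : volume T ≠ 0 := (Metric.measure_closedBall_pos volume _ hr).ne'
  have : IsFiniteMeasure (volume.restrict T) := isFiniteMeasure_restrict.mpr hT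
  refine ⟨T, fun _ => ((volume.real T)⁻¹ : ℝ), hTm, hT, ?_, memLp_const _, ?_⟩
  · refine (ae_restrict_iff' hTm).mpr (Filter.Eventually.of_forall fun ξ hξ => ?_)
    rw [hTdef, mem_closedBall_zero_iff, le_div_iff₀ (by positivity)] at hξ
    rw [freq, norm_smul, Real.norm_of_nonneg (by positivity), mul_comm]
    exact hξ
  · have hreal : volume.real T ≠ 0 := (ENNReal.toReal_pos hT0 hT).ne'
    simp only [bandSynth, synth, inner_zero_right, Complex.ofReal_zero, mul_zero, Complex.exp_zero,
      one_mul, setIntegral_const, Complex.real_smul]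
    rw [← Complex.ofReal_mul, mul_inv_cancel₀ hreal, Complex.ofReal_one]

theorem exists_pos_le_frameEnergy (hSm : MeasurableSet S) (hS : volume S ≠ ⊤)
    (hp : ∀ᵐ ξ ∂(volume.restrict S), ‖freq ξ‖ ≤ m) (hm : 0 ≤ m)
    (hV : IsCellCover N x V δ) (hb0 : 0 < b) (hb : ∀ v, ‖v‖ ≤ b * N v)
    (k : ℕ) (hR : expRemainder k (m * (b * δ)) < 1) :
    ∃ A : ℝ, 0 < A ∧ ∀ g : Rd d → ℂ, MemLp g 2 (volume.restrict S) →
      ENNReal.ofReal A * ∫⁻ ξ in S, ‖g ξ‖ₑ ^ 2 ≤ frameEnergy S g k x V := by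
  obtain ⟨ε, hε, hRε⟩ : ∃ ε > 0, expRemainder k ((m + ε) * (b * δ)) < 1 := by
    have hc : Continuous fun ε => expRemainder k ((m + ε) * (b * δ)) :=
      (continuous_expRemainder k).comp (by fun_prop)
    have h0 : ∀ᶠ ε in nhds (0 : ℝ), expRemainder k ((m + ε) * (b * δ)) < 1 :=
      hc.continuousAt.eventually (gt_mem_nhds (by simpa using hR))
    obtain ⟨r, hr, hball⟩ := Metric.eventually_nhds_iff.mp h0
    refine ⟨r / 2, by positivity, hball ?_⟩
    rw [Real.dist_0_eq_abs, abs_of_pos (by positivity)]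
    linarith
  set R := expRemainder k ((m + ε) * (b * δ)) with hRdef
  set η := (1 - R) / 3 with hη
  have hη0 : 0 < η := by rw [hη]; linarith
  obtain ⟨ρ₀, hρ₀, hρη⟩ : ∃ ρ₀ > 0, expRemainder 0 ((m + ε) * ρ₀) ≤ η := by
    have hc : Continuous fun ρ => expRemainder 0 ((m + ε) * ρ) :=
      (continuous_expRemainder 0).comp (by fun_prop)
    have h0 : ∀ᶠ ρ in nhds (0 : ℝ), expRemainder 0 ((m + ε) * ρ) < η :=
      hc.continuousAt.eventually (gt_mem_nhds (by simpa [expRemainder] using hη0))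
    obtain ⟨r, hr, hball⟩ := Metric.eventually_nhds_iff.mp h0
    refine ⟨r / 2, by positivity, (hball ?_).le⟩
    rw [Real.dist_0_eq_abs, abs_of_pos (by positivity)]
    linarith
  obtain ⟨T, θ, hTm, hT, hq, hθ, hθ1⟩ := exists_window d hε
  have hc0 : 0 < volume (Metric.closedBall (0 : Rd d) ρ₀) :=
    Metric.measure_closedBall_pos volume _ hρ₀
  have hct : volume (Metric.closedBall (0 : Rd d) ρ₀) ≠ ⊤ := measure_closedBall_lt_top.ne
  set c₀ := ENNReal.ofReal η ^ 2 * volume (Metric.closedBall (0 : Rd d) ρ₀) with hc₀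
  have hc₀0 : c₀ ≠ 0 := mul_ne_zero (pow_ne_zero _ (ENNReal.ofReal_pos.mpr hη0).ne') hc0.ne'
  have hc₀t : c₀ ≠ ⊤ := ENNReal.mul_ne_top (by finiteness) hct
  set K := ((k + 1 : ℕ) : ENNReal) ^ 3 * ENNReal.ofReal (Real.exp d) with hK
  have hKt : K ≠ ⊤ := by rw [hK]; finiteness
  set W := windowMajorant T θ k (b * δ) with hW
  have hWm : Measurable W := measurable_windowMajorant hT hq hθ k _
  have hWt : ∫⁻ v, W v ≠ ⊤ := lintegral_windowMajorant_ne_top hTm hT hq hθ k _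
  have hmain : ∀ g : Rd d → ℂ, MemLp g 2 (volume.restrict S) →
      c₀ * ∫⁻ ξ in S, ‖g ξ‖ₑ ^ 2 ≤ K * (∫⁻ v, W v) * frameEnergy S g k x V := by
    intro g hg
    have hgi := integrable_of_memLp_two hS hg
    have hθi := integrable_of_memLp_two hT hθ
    have hpt : ∀ y, c₀ * ‖bandSynth S g y‖ₑ ^ 2 ≤ ∑' n, K *
        ((∫⁻ w in V n, localEnergy S g k (x n) (w - x n)) * W (x n - y)) := fun y => by
      have h1 := sup_sq_le_tsum_taylorSum aestronglyMeasurable_freq_add (norm_freq_add_le hp hq)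
        (by positivity) (integrable_prodSpec hgi hθi y) hV hb0 hb k le_rfl hη0
        (by rw [hη]; linarith) hρη y
      rw [synth_prodSpec hp hq hgi hθi, sub_self, hθ1, mul_one] at h1
      refine h1.trans (ENNReal.tsum_le_tsum fun n => ?_)
      have hmeas : Measurable fun w => localEnergy S g k (x n) (w - x n) :=
        (measurable_localEnergy k (x n)).comp (measurable_sub_const _)
      rw [← lintegral_mul_const _ hmeas, ← lintegral_const_mul _ (hmeas.mul_const _)]
      refine setLIntegral_mono' (hV.measurableSet n) fun w hw => ?_
      refine enorm_taylorSum_prodSpec_sq_le hS hT hp hq hg hθ y (x n) ((hb _).trans ?_) k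
      gcongr
      exact hV.dist_le n w hw
    have hWn : ∀ n, Measurable fun y => W (x n - y) := fun n =>
      hWm.comp (measurable_const_sub _)
    calc c₀ * ∫⁻ ξ in S, ‖g ξ‖ₑ ^ 2 = ∫⁻ y, c₀ * ‖bandSynth S g y‖ₑ ^ 2 := by
          rw [lintegral_const_mul _ (measurable_enorm_sq_bandSynth hS hg),
            lintegral_synth_sq hSm hS hg]
      _ ≤ ∫⁻ y, ∑' n, K *
          ((∫⁻ w in V n, localEnergy S g k (x n) (w - x n)) * W (x n - y)) :=
          lintegral_mono hpt
      _ = ∑' n, K * ((∫⁻ w in V n, localEnergy S g k (x n) (w - x n)) * ∫⁻ v, W v) := by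
          rw [lintegral_tsum fun n => (((hWn n).const_mul _).const_mul _).aemeasurable]
          congr with n
          rw [lintegral_const_mul _ ((hWn n).const_mul _), lintegral_const_mul _ (hWn n),
            lintegral_sub_left_eq_self]
      _ = _ := by
          rw [ENNReal.tsum_mul_left, ENNReal.tsum_mul_right, frameEnergy]
          ring
  set L := K * (∫⁻ v, W v) + 1 with hL
  have hLt : L ≠ ⊤ := ENNReal.add_ne_top.mpr ⟨ENNReal.mul_ne_top hKt hWt, ENNReal.one_ne_top⟩
  have hL0 : L ≠ 0 := by rw [hL]; simp
  refine ⟨(c₀ / L).toReal, ENNReal.toReal_pos (ENNReal.div_pos hc₀0 hLt).ne'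
    (ENNReal.div_ne_top hc₀t hL0), fun g hg => ?_⟩
  rw [ENNReal.ofReal_toReal (ENNReal.div_ne_top hc₀t hL0), ENNReal.div_eq_inv_mul, mul_assoc,
    ENNReal.inv_mul_le_iff hL0 hLt]
  refine (hmain g hg).trans ?_
  gcongr
  exact le_self_add

end lower

section frame

variable {d : ℕ} {Ω : Set (Rd d)} {N : Seminorm ℝ (Rd d)} {I : Type*} {x : I → Rd d} {δ : ℝ}

theorem tsum_multiIndexLE (d k : ℕ) (φ : (Fin d → ℕ) → ENNReal) :
    ∑' α : MultiIndexLE d k, φ α.1 =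
      ∑ r ∈ Finset.range (k + 1), ∑ α ∈ multiIndices d r, φ α := by
  classical
  have hdisj : Set.PairwiseDisjoint (Finset.range (k + 1) : Set ℕ) (multiIndices d) := by
    intro r _ s _ hrs
    refine Finset.disjoint_left.mpr fun α h1 h2 => hrs ?_
    rw [← (Finset.mem_piAntidiag.mp h1).1, (Finset.mem_piAntidiag.mp h2).1]
  rw [← Finset.sum_biUnion hdisj, ← Finset.tsum_subtype]
  have hmem : ∀ α : Fin d → ℕ, ∑ i, α i ≤ k ↔
      α ∈ (Finset.range (k + 1)).biUnion (multiIndices d) := fun α => by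
    simp [Finset.mem_piAntidiag]
  exact (Equiv.subtypeEquivRight hmem).tsum_eq
    (fun a : {a // a ∈ (Finset.range (k + 1)).biUnion (multiIndices d)} => φ a.1)

theorem sampleWeight_nonneg (N : Seminorm ℝ (Rd d)) (x : I → Rd d) (n : I) (α : Fin d → ℕ) :
    0 ≤ sampleWeight N x n α :=
  mul_nonneg (by positivity) (integral_nonneg fun y => Finset.prod_nonneg fun i _ =>
    (even_two_mul _).pow_nonneg _)

theorem ofReal_sampleWeight (hN : ∀ v, N v = 0 → v = 0)
    (hV : IsCellCover N x (voronoiCell N x) δ) (n : I) (α : Fin d → ℕ) :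
    ENNReal.ofReal (sampleWeight N x n α) = ∫⁻ y in voronoiCell N x n,
      ENNReal.ofReal (1 / ∏ i, ((α i).factorial : ℝ)) * (∏ i, ‖(y - x n) i‖ₑ ^ α i) ^ 2 := by
  obtain ⟨b, hb0, hb⟩ := exists_norm_le_mul hN
  have hint : IntegrableOn (fun y : Rd d => ∏ i, (y i - x n i) ^ (2 * α i))
      (voronoiCell N x n) := by
    have hc : Continuous fun y : Rd d => ∏ i, (y i - x n i) ^ (2 * α i) := by fun_prop
    refine (hc.continuousOn.integrableOn_compact
      (isCompact_closedBall (x n) (b * δ))).mono_set fun y hy => ?_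
    rw [mem_closedBall_iff_norm]
    exact (hb _).trans (by gcongr; exact hV.dist_le n y hy)
  rw [sampleWeight, ENNReal.ofReal_mul (by positivity), lintegral_const_mul' _ _
    ENNReal.ofReal_ne_top, ofReal_integral_eq_lintegral_ofReal hint (Filter.Eventually.of_forall
    fun y => Finset.prod_nonneg fun i _ => (even_two_mul _).pow_nonneg _)]
  congr 1
  refine lintegral_congr fun y => ?_
  rw [ENNReal.ofReal_prod_of_nonneg fun i _ => (even_two_mul _).pow_nonneg _, ← Finset.prod_pow]
  refine Finset.prod_congr rfl fun i _ => ?_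
  rw [← ofReal_norm, ← ENNReal.ofReal_pow (norm_nonneg _), ← ENNReal.ofReal_pow (by positivity),
    PiLp.sub_apply, ← pow_mul, mul_comm (α i), pow_mul, pow_mul, Real.norm_eq_abs, sq_abs]

theorem tsum_sampleWeight_mul (hN : ∀ v, N v = 0 → v = 0)
    (hV : IsCellCover N x (voronoiCell N x) δ) (S : Set (Rd d)) (g : Rd d → ℂ) (k : ℕ) :
    ∑' j : I × MultiIndexLE d k, ENNReal.ofReal (sampleWeight N x j.1 j.2.1) *
      ‖bandSynth S (monoSym freq j.2.1 g) (x j.1)‖ₑ ^ 2 =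
      frameEnergy S g k x (voronoiCell N x) := by
  rw [ENNReal.tsum_prod', frameEnergy]
  congr with n
  dsimp only
  have hm1 : ∀ α : Fin d → ℕ, Measurable fun y : Rd d =>
      ENNReal.ofReal (1 / ∏ i, ((α i).factorial : ℝ)) * (∏ i, ‖(y - x n) i‖ₑ ^ α i) ^ 2 := by
    intro α
    have : Measurable fun y : Rd d => ∏ i, ‖(y - x n) i‖ₑ ^ α i :=
      Finset.measurable_fun_prod _ fun i _ => Measurable.pow_const (by fun_prop) _
    exact (this.pow_const 2).const_mul _
  rw [tsum_multiIndexLE d k fun α => ENNReal.ofReal (sampleWeight N x n α) *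
      ‖bandSynth S (monoSym freq α g) (x n)‖ₑ ^ 2]
  simp only [localEnergy]
  rw [lintegral_finsetSum _ fun r _ => Finset.measurable_fun_sum _ fun α _ =>
    (hm1 α).mul_const _]
  refine Finset.sum_congr rfl fun r _ => ?_
  rw [lintegral_finsetSum _ fun α _ => (hm1 α).mul_const _]
  refine Finset.sum_congr rfl fun α _ => ?_
  rw [lintegral_mul_const _ (hm1 α), ofReal_sampleWeight hN hV]

theorem isDerivativeFrame_of_energy_bounds (hΩ : IsCompact Ω) (hN : ∀ v, N v = 0 → v = 0)
    (hV : IsCellCover N x (voronoiCell N x) δ) (k : ℕ) {A B : ℝ} (hA : 0 < A) (hB : 0 < B)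
    (hlow : ∀ G, MemLp G 2 (volume.restrict (scaledBand Ω)) →
      ENNReal.ofReal A * ∫⁻ ξ in scaledBand Ω, ‖G ξ‖ₑ ^ 2 ≤
        frameEnergy (scaledBand Ω) G k x (voronoiCell N x))
    (hup : ∀ G, MemLp G 2 (volume.restrict (scaledBand Ω)) →
      frameEnergy (scaledBand Ω) G k x (voronoiCell N x) ≤
        ENNReal.ofReal B * ∫⁻ ξ in scaledBand Ω, ‖G ξ‖ₑ ^ 2) :
    IsDerivativeFrame Ω N x k A B := by
  choose ψ hψ hψi using fun j : I × MultiIndexLE d k =>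
    exists_dual hΩ (Real.sqrt (sampleWeight N x j.1 j.2.1)) j.2.1 (x j.1)
  refine ⟨ψ, fun n α => hψ (n, α), hA, hB, fun f => ?_⟩
  obtain ⟨G, hG, -, hGf, hGi⟩ := exists_spectrum hΩ f
  have hj : ∀ j, ENNReal.ofReal (‖inner ℂ (ψ j) f‖ ^ 2) =
      ENNReal.ofReal (sampleWeight N x j.1 j.2.1) *
        ‖bandSynth (scaledBand Ω) (monoSym freq j.2.1 G) (x j.1)‖ₑ ^ 2 := fun j => by
    rw [hψi j f G hGi, mul_pow, sq_abs, Real.sq_sqrt (sampleWeight_nonneg _ _ _ _),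
      ENNReal.ofReal_mul (sampleWeight_nonneg _ _ _ _), ENNReal.ofReal_pow (norm_nonneg _),
      ofReal_norm]
  have hsum : ∑' j, ENNReal.ofReal (‖inner ℂ (ψ j) f‖ ^ 2) =
      frameEnergy (scaledBand Ω) G k x (voronoiCell N x) := by
    simp_rw [hj]
    exact tsum_sampleWeight_mul hN hV _ G k
  have hle := hlow G hG
  have hge := hup G hG
  rw [← hsum, hGf, ← ENNReal.ofReal_mul (by positivity)] at hle hge
  have htop : ∑' j, ENNReal.ofReal (‖inner ℂ (ψ j) f‖ ^ 2) ≠ ⊤ :=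
    (hge.trans_lt ENNReal.ofReal_lt_top).ne
  have hs : Summable fun j => ‖inner ℂ (ψ j) f‖ ^ 2 := by
    have := ENNReal.summable_toReal htop
    simpa only [ENNReal.toReal_ofReal (sq_nonneg _)] using this
  rw [← ENNReal.ofReal_tsum_of_nonneg (fun _ => sq_nonneg _) hs] at hle hge
  exact ⟨hs, (ENNReal.ofReal_le_ofReal_iff (tsum_nonneg fun _ => sq_nonneg _)).mp hle,
    (ENNReal.ofReal_le_ofReal_iff (by positivity)).mp hge⟩

theorem norm_le_bandRadius (hΩ : IsCompact Ω) {ω : Rd d} (hω : ω ∈ Ω) : ‖ω‖ ≤ bandRadius Ω :=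
  le_csSup (hΩ.image continuous_norm).bddAbove ⟨ω, hω, rfl⟩

theorem bandRadius_nonneg (Ω : Set (Rd d)) : 0 ≤ bandRadius Ω :=
  Real.sSup_nonneg (by rintro _ ⟨ω, -, rfl⟩; exact norm_nonneg ω)

theorem volume_singleton_Rd (hd : 1 ≤ d) (a : Rd d) : volume ({a} : Set (Rd d)) = 0 := by
  have : Nonempty (Fin d) := ⟨⟨0, hd⟩⟩
  exact measure_singleton a

theorem isCellCover_delta_pos (hd : 1 ≤ d) (hN : ∀ v, N v = 0 → v = 0)
    {V : I → Set (Rd d)} (hV : IsCellCover N x V δ) : 0 < δ := by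
  by_contra! h
  have h0 : ∀ n, volume (V n) = 0 := fun n => by
    refine measure_mono_null (fun y hy => ?_) (volume_singleton_Rd hd (x n))
    have : N (y - x n) = 0 := le_antisymm ((hV.dist_le n y hy).trans h) (apply_nonneg N _)
    exact sub_eq_zero.mp (hN _ this)
  have h1 := hV.tsum_lintegral 1
  have h2 : volume (Set.univ : Set (Rd d)) = 0 := by simpa [h0] using h1.symm
  exact (isOpen_univ.measure_pos volume Set.univ_nonempty).ne' h2

theorem scaledBand_null (hd : 1 ≤ d) (hΩ : IsCompact Ω) (hm : bandRadius Ω = 0) :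
    volume (scaledBand Ω) = 0 := by
  refine measure_mono_null (fun ξ hξ => ?_) (volume_singleton_Rd hd 0)
  have h1 : ‖freq ξ‖ ≤ 0 := hm ▸ norm_le_bandRadius hΩ hξ
  rw [freq, norm_smul, Real.norm_of_nonneg (by positivity)] at h1
  have h2 : ‖ξ‖ ≤ 0 := by
    by_contra! h
    have := Real.pi_pos
    nlinarith [mul_pos (mul_pos two_pos this) h]
  exact norm_le_zero_iff.mp h2

theorem expRemainder_zero (k : ℕ) : expRemainder k 0 = 0 := by
  have h := hasSum_expRemainder k 0
  simp only [ne_eq, Nat.add_eq_zero_iff, one_ne_zero, and_false, not_false_eq_true, zero_pow,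
    zero_div] at h
  exact h.unique hasSum_zero

theorem sq_expRemainder_mul_le_gFun_sq (k d : ℕ) {z : ℝ} (hz : 0 ≤ z) :
    ENNReal.ofReal (expRemainder k z) ^ 2 * (ENNReal.ofReal ((1 + sigmaStar d z) ^ d) *
      ENNReal.ofReal (Real.exp (z / sigmaStar d z)) ^ 2) ≤ ENNReal.ofReal (gFun k d z ^ 2) := by
  have hR := expRemainder_nonneg k hz
  have hs := sigmaStar_nonneg d hz
  rw [← ENNReal.ofReal_pow hR, ← ENNReal.ofReal_pow (by positivity),
    ← ENNReal.ofReal_mul (by positivity), ← ENNReal.ofReal_mul (by positivity)]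
  refine ENNReal.ofReal_le_ofReal ?_
  have h1 : ((1 + 2 * sigmaStar d z) ^ ((d : ℝ) / 2)) ^ 2 = (1 + 2 * sigmaStar d z) ^ d := by
    rw [← Real.rpow_natCast, ← Real.rpow_mul (by positivity)]
    norm_num
  rw [gFun, mul_pow, mul_pow, h1, mul_comm]
  gcongr
  linarith

theorem sq_expRemainder_mul_eq_hFun_sq (k : ℕ) {z : ℝ} (hz : 0 ≤ z) :
    ENNReal.ofReal (expRemainder k z) ^ 2 * ENNReal.ofReal (Real.exp z) ^ 2 =
      ENNReal.ofReal (hFun k z ^ 2) := by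
  have hR := expRemainder_nonneg k hz
  rw [← mul_pow, ← ENNReal.ofReal_mul hR, ← ENNReal.ofReal_pow (by positivity), hFun, mul_comm]

theorem exists_derivativeFrame [Countable I] (hd : 1 ≤ d) (hΩ : IsCompact Ω)
    (hN : ∀ v, N v = 0 → v = 0) (hV : IsCellCover N x (voronoiCell N x) δ) (k : ℕ) {z : ℝ}
    (hz : z = bandRadius Ω * normConst N * δ) (hR : expRemainder k z < 1) :
    ∃ A B : ℝ, IsDerivativeFrame Ω N x k A B ∧
      (min (hFun k z) (gFun k d z) ≤ 1 →
        Real.exp (-d) * (1 - min (hFun k z) (gFun k d z)) ^ 2 ≤ A) ∧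
      B ≤ Real.exp (2 * z + z ^ 2) := by
  have hδ := isCellCover_delta_pos hd hN hV
  have hb0 := normConst_pos hd hN
  have hb := norm_le_normConst_mul hN
  have hSm := measurableSet_scaledBand hΩ
  have hS := volume_scaledBand_ne_top hΩ
  have hp := norm_freq_le hΩ fun ω hω => norm_le_bandRadius hΩ hω
  rcases (bandRadius_nonneg Ω).eq_or_lt with hm | hm
  · have hz0 : z = 0 := by rw [hz, ← hm]; ring
    have hnull : volume.restrict (scaledBand Ω) = 0 :=
      Measure.restrict_eq_zero.mpr (scaledBand_null hd hΩ hm.symm)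
    refine ⟨Real.exp (-d), 1, isDerivativeFrame_of_energy_bounds hΩ hN hV k (Real.exp_pos _)
      one_pos (fun G _ => ?_) (fun G _ => ?_), fun _ => ?_, ?_⟩
    · simp [hnull]
    · simp [hnull, frameEnergy, localEnergy, bandSynth, synth]
    · simp [hz0, hFun, gFun, expRemainder_zero]
    · simp [hz0]
  · set m := bandRadius Ω
    set b := normConst N
    have hzpos : 0 < z := by rw [hz]; positivity
    have hz1 : b * δ * m = z := by rw [hz]; ring
    have hz2 : m * (b * δ) = z := by rw [hz]; ring
    have hup : ∀ G, MemLp G 2 (volume.restrict (scaledBand Ω)) →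
        frameEnergy (scaledBand Ω) G k x (voronoiCell N x) ≤
          ENNReal.ofReal (Real.exp (2 * z + z ^ 2)) * ∫⁻ ξ in scaledBand Ω, ‖G ξ‖ₑ ^ 2 :=
      fun G hG => by
        have h := frameEnergy_le hSm hS hp hG hV hb0 hb hδ hm k
        rwa [hz1] at h
    have hRpos := expRemainder_pos k hzpos
    have hσ := sigmaStar_pos hd hzpos
    set q := min (hFun k z) (gFun k d z) with hq
    have hq0 : 0 < q := lt_min (by unfold hFun; positivity) (by unfold gFun; positivity)
    rcases lt_or_ge q 1 with hq1 | hq1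
    · have hA : 0 < Real.exp (-d) * (1 - q) ^ 2 :=
        mul_pos (Real.exp_pos _) (pow_pos (by linarith) 2)
      refine ⟨_, _, isDerivativeFrame_of_energy_bounds hΩ hN hV k hA (Real.exp_pos _)
        (fun G hG => ?_) hup, fun _ => le_rfl, le_rfl⟩
      rcases min_choice (hFun k z) (gFun k d z) with hmin | hmin
      · refine le_frameEnergy hSm hS hp hG hV hb0 hb hδ hm k hq0 hq1
          (C := ENNReal.ofReal (Real.exp z) ^ 2) (fun r => ?_) ?_
        · have h := tsum_jetSq_le hSm hS hp hG hV hb0 hb hδ hm r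
          rwa [hz1] at h
        · rw [hz1, hq, hmin]
          exact (sq_expRemainder_mul_eq_hFun_sq k hzpos.le).le
      · refine le_frameEnergy hSm hS hp hG hV hb0 hb hδ hm k hq0 hq1
          (C := ENNReal.ofReal ((1 + sigmaStar d z) ^ d) *
            ENNReal.ofReal (Real.exp (z / sigmaStar d z)) ^ 2) (fun r => ?_) ?_
        · have h := tsum_jetSq_le_of_averaging hSm hS hp hG hN hV hb0 hb hδ hm hσ r
          rwa [hz1] at h
        · rw [hz1, hq, hmin]
          exact sq_expRemainder_mul_le_gFun_sq k d hzpos.le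
    · obtain ⟨A, hA, hlow⟩ := exists_pos_le_frameEnergy hSm hS hp hm.le hV hb0 hb k
        (by rwa [hz2])
      refine ⟨A, _, isDerivativeFrame_of_energy_bounds hΩ hN hV k hA (Real.exp_pos _) hlow hup,
        fun h1 => ?_, le_rfl⟩
      rw [le_antisymm h1 hq1]
      simpa using hA.le

theorem le_of_sampleGap_lt (hd : 1 ≤ d) (hN : ∀ v, N v = 0 → v = 0) {t z : ℝ} (ht : 0 ≤ t)
    (h : sampleGap N x < ENNReal.ofReal t / ENNReal.ofReal (bandRadius Ω * normConst N))
    (hz : z = bandRadius Ω * normConst N * (sampleGap N x).toReal) : z ≤ t := by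
  rcases (bandRadius_nonneg Ω).eq_or_lt with hm | hm
  · rw [hz, ← hm]; simpa using ht
  have hmb : 0 < bandRadius Ω * normConst N := mul_pos hm (normConst_pos hd hN)
  rw [← ENNReal.ofReal_div_of_pos hmb, ENNReal.lt_ofReal_iff_toReal_lt h.ne_top,
    lt_div_iff₀ hmb] at h
  rw [hz, mul_comm]
  exact h.le

end frame

theorem corollary3p3 (d : ℕ) (hd : 1 ≤ d) :
    -- the threshold `(k + 1) / (e m_Ω b)` itself
    (∃ K : ℕ, ∀ k : ℕ, K ≤ k →
      ∀ (Ω : Set (Rd d)) (_ : IsCompact Ω)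
        (N : Seminorm ℝ (Rd d)) (_ : ∀ v, N v = 0 → v = 0)
        (I : Type*) (_ : Countable I) (x : I → Rd d)
        (_ : ∀ᵐ y : Rd d, ∃! n, y ∈ voronoiCell N x n)
        (_ : sampleGap N x <
          ENNReal.ofReal ((k + 1) / Real.exp 1) / ENNReal.ofReal (bandRadius Ω * normConst N))
        (z : ℝ) (_ : z = bandRadius Ω * normConst N * (sampleGap N x).toReal),
        ∃ A B : ℝ, IsDerivativeFrame Ω N x k A B ∧
          (min (hFun k z) (gFun k d z) ≤ 1 →
            Real.exp (-d) * (1 - min (hFun k z) (gFun k d z)) ^ 2 ≤ A) ∧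
          B ≤ Real.exp (2 * z + z ^ 2)) ∧
    -- for every constant `c < 1 / e` the lower estimate is the positive one
    (∀ c : ℝ, 0 < c → c < 1 / Real.exp 1 → ∃ K : ℕ, ∀ k : ℕ, K ≤ k →
      ∀ (Ω : Set (Rd d)) (_ : IsCompact Ω)
        (N : Seminorm ℝ (Rd d)) (_ : ∀ v, N v = 0 → v = 0)
        (I : Type*) (_ : Countable I) (x : I → Rd d)
        (_ : ∀ᵐ y : Rd d, ∃! n, y ∈ voronoiCell N x n)
        (_ : sampleGap N x <
          ENNReal.ofReal (c * (k + 1)) / ENNReal.ofReal (bandRadius Ω * normConst N))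
        (z : ℝ) (_ : z = bandRadius Ω * normConst N * (sampleGap N x).toReal),
        ∃ A B : ℝ, IsDerivativeFrame Ω N x k A B ∧
          min (hFun k z) (gFun k d z) < 1 ∧
          Real.exp (-d) * (1 - min (hFun k z) (gFun k d z)) ^ 2 ≤ A ∧
          B ≤ Real.exp (2 * z + z ^ 2)) := by
  refine ⟨⟨0, ?_⟩, ?_⟩
  · intro k _ Ω hΩ N hN I _ x hx hgap z hz
    have hzk := le_of_sampleGap_lt hd hN (by positivity) hgap hz
    have hz0 : 0 ≤ z := by
      have := bandRadius_nonneg Ω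
      have := normConst_pos hd hN
      rw [hz]; positivity
    exact exists_derivativeFrame hd hΩ hN (isCellCover_voronoi hx hgap.ne_top) k hz
      (expRemainder_lt_one hz0 hzk)
  · intro c hc0 hc
    obtain ⟨K, hK⟩ := exists_gFun_lt_one hd hc0 hc
    refine ⟨K, ?_⟩
    intro k hk Ω hΩ N hN I _ x hx hgap z hz
    have hzk := le_of_sampleGap_lt hd hN (by positivity) hgap hz
    have hz0 : 0 ≤ z := by
      have := bandRadius_nonneg Ω
      have := normConst_pos hd hN
      rw [hz]; positivity
    have hR : expRemainder k z < 1 := by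
      refine expRemainder_lt_one hz0 (hzk.trans ?_)
      rw [div_eq_mul_one_div, mul_comm]
      gcongr
    have hq : min (hFun k z) (gFun k d z) < 1 :=
      (min_le_right _ _).trans_lt (hK k hk z hz0 hzk)
    obtain ⟨A, B, hF, hA, hB⟩ :=
      exists_derivativeFrame hd hΩ hN (isCellCover_voronoi hx hgap.ne_top) k hz hR
    exact ⟨A, B, hF, hq, hA hq.le, hB⟩
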